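/- Let $\mathbb T=\mathbb R/\mathbb Z$, let $\mathrm{Diff}^k(\mathbb T)$ be the set of orientation-preserving $C^k$-diffeomorphisms of $\mathbb T$, with $\mathrm{Diff}^1(\mathbb T)$ carrying the $C^1$-topology and its Borel $\sigma$-algebra, and write $\mathcal S_\psi=\psi'''/\psi'-\tfrac32(\psi''/\psi')^2$. Let $\sigma>0$. For $\alpha\in\mathbb R\cup i\mathbb R$, a Radon measure $\mu$ on $\mathrm{Diff}^1(\mathbb T)$ is called an (unquotiented Virasoro) $\alpha$-orbital measure if for every $\psi\in\mathrm{Diff}^3(\mathbb T)$ the measure $\psi^*\mu(A)=\mu(\{\psi\circ\phi:\phi\in A\})$ satisfies $$\frac{d\psi^*\mu}{d\mu}(\phi)=\exp\Big\{\frac1{\sigma^2}\int_{\mathbb T}\big[\mathcal S_\psi(\phi(\tau))+2\alpha^2\big(\psi'(\phi(\tau))^2-1\big)\big]\phi'(\tau)^2\,d\tau\Big\}.$$ Let $\mu$ be an $\alpha_0$-orbital measure for some $\alpha_0$ with $\alpha_0^2\in\mathbb R$, and for $\alpha^2\in\mathbb R$ put $$d\mu^{\alpha}(\phi)=\exp\Big\{\frac{2(\alpha^2-\alpha_0^2)}{\sigma^2}\int_{\mathbb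 T}\phi'(\tau)^2\,d\tau\Big\}\,d\mu(\phi).$$ For $t_0\in\mathbb T$ let $[F(\phi)]^{\alpha,t_0}_{\sigma^2}=\int F(\phi-\phi(t_0))\,d\mu^{\alpha}(\phi)$ be the unnormalised expectation under the $\alpha$-orbital measure pinned at $t_0$. Let $t_0\in\mathbb T$ and let $\alpha\in\mathbb R\cup i\mathbb R$ with $\alpha^2<\pi^2$. Put $$f_\alpha(t)=\frac12\Big(\frac{1}{\tan\frac\alpha2}\tan\big(\alpha(t-\tfrac12)\big)+1\Big),\qquad t\in[0,1],$$ with the conventions $f_\alpha(t)=t$ and $\alpha/\sin\alpha=1$ if $\alpha=0$. Then $f_\alpha$ is a real-valued orientation-preserving $C^3$-diffeomorphism of $[0,1]$ with $f_\alpha(0)=0$, $f_\alpha(1)=1$ and constant Schwarzian derivative $\mathcal S_{f_\alpha}=2\alpha^2$, it induces an element of $\mathrm{Diff}^1(\mathbb T)$, and $$\big[G(f_\alpha\circ\phi)\big]^{\alpha,t_0}_{\sigma^2}=\frac{\alpha}{\sin\alpha}\Big[G(\phi)\exp\Big\{\frac{8\sin^2(\alpha/2)}{\sigma^2}\,\phi'(t_0)\Big\}\Big]^{0,t_0}_{\sigma^2}$$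 for every measurable $G:\mathrm{Diff}^1(\mathbb T)\to[0,\infty]$ (both sides may be infinite), and likewise for every measurable $G:\mathrm{Diff}^1(\mathbb T)\to\mathbb R$ for which one of the two sides is absolutely integrable; in that case so is the other. -/

import Mathlib

open MeasureTheory Set
open scoped ENNReal

noncomputable section

/-- `g : ℝ → ℝ` is the lift of an orientation preserving `C¹`-diffeomorphism of `ℝ / ℤ`. -/
structure IsCircleDiffLift (g : ℝ → ℝ) : Prop where
  contDiff : ContDiff ℝ 1 g
  map_add_one : ∀ x, g (x + 1) = g x + 1
  deriv_pos : ∀ x, 0 < deriv g x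

/-- `Diff¹(𝕋)`, `𝕋 = ℝ / ℤ`: the orientation preserving `C¹`-diffeomorphisms of the unit circle. -/
structure CircleDiff where
  toFun : UnitAddCircle → UnitAddCircle
  exists_lift : ∃ g : ℝ → ℝ, IsCircleDiffLift g ∧
    ∀ x : ℝ, toFun (x : UnitAddCircle) = (g x : UnitAddCircle)

namespace CircleDiff

instance : CoeFun CircleDiff (fun _ => UnitAddCircle → UnitAddCircle) := ⟨CircleDiff.toFun⟩

/-- A lift of `φ` to `ℝ`; it is unique up to adding an integer constant. -/
def lift (φ : CircleDiff) : ℝ → ℝ := Classical.choose φ.exists_lift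

theorem isLift (φ : CircleDiff) : IsCircleDiffLift φ.lift :=
  (Classical.choose_spec φ.exists_lift).1

theorem coe_lift (φ : CircleDiff) (x : ℝ) : φ (x : UnitAddCircle) = (φ.lift x : UnitAddCircle) :=
  (Classical.choose_spec φ.exists_lift).2 x

theorem continuous_toFun (φ : CircleDiff) : Continuous φ.toFun := by
  apply continuous_coinduced_dom.mpr
  have h : (φ.toFun ∘ fun x : ℝ => (x : UnitAddCircle))
      = fun x : ℝ => (φ.lift x : UnitAddCircle) := funext φ.coe_lift
  exact h ▸ (AddCircle.continuous_mk' (1 : ℝ)).comp φ.isLift.contDiff.continuous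

theorem periodic_deriv_lift (φ : CircleDiff) : Function.Periodic (deriv φ.lift) 1 := by
  intro x
  have h : (fun y => φ.lift (y + 1)) = fun y => φ.lift y + 1 := funext φ.isLift.map_add_one
  have h1 := deriv_comp_add_const (f := φ.lift) (a := (1 : ℝ)) (x := x)
  rw [← h1, h, deriv_add_const]

/-- The derivative `φ' : 𝕋 → ℝ`. -/
def derivative (φ : CircleDiff) : C(UnitAddCircle, ℝ) where
  toFun := φ.periodic_deriv_lift.lift
  continuous_toFun := by
    apply continuous_coinduced_dom.mpr
    exact φ.isLift.contDiff.continuous_deriv le_rfl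

/-- `φ` as a continuous map. -/
def toContinuousMap (φ : CircleDiff) : C(UnitAddCircle, UnitAddCircle) :=
  ⟨φ.toFun, φ.continuous_toFun⟩

/-- The `C¹` topology: uniform convergence of `φ` and of `φ'`. -/
instance : TopologicalSpace CircleDiff :=
  TopologicalSpace.induced (fun φ => (φ.toContinuousMap, φ.derivative)) inferInstance

instance : MeasurableSpace CircleDiff := borel CircleDiff

instance : BorelSpace CircleDiff := ⟨rfl⟩

/-- Membership in `Diff³(𝕋)`. -/
def IsC3 (ψ : CircleDiff) : Prop := ContDiff ℝ 3 ψ.lift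

/-- The composition `ψ ∘ φ`. -/
def comp (ψ φ : CircleDiff) : CircleDiff where
  toFun := ψ.toFun ∘ φ.toFun
  exists_lift := by
    refine ⟨ψ.lift ∘ φ.lift, ⟨ψ.isLift.contDiff.comp φ.isLift.contDiff, fun x => ?_, fun x => ?_⟩,
      fun x => ?_⟩
    · simp only [Function.comp_apply, φ.isLift.map_add_one, ψ.isLift.map_add_one]
    · rw [deriv_comp x (ψ.isLift.contDiff.differentiable one_ne_zero _)
        (φ.isLift.contDiff.differentiable one_ne_zero _)]
      exact mul_pos (ψ.isLift.deriv_pos _) (φ.isLift.deriv_pos _)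
    · simp only [Function.comp_apply, φ.coe_lift, ψ.coe_lift]

/-- The rotated diffeomorphism `φ + θ`. -/
def rotate (φ : CircleDiff) (θ : UnitAddCircle) : CircleDiff where
  toFun := fun t => φ t + θ
  exists_lift := by
    obtain ⟨c, rfl⟩ := QuotientAddGroup.mk_surjective θ
    refine ⟨fun x => φ.lift x + c, ⟨φ.isLift.contDiff.add contDiff_const, fun x => ?_, fun x => ?_⟩,
      fun x => ?_⟩
    · rw [φ.isLift.map_add_one]; ring
    · rw [deriv_add_const]; exact φ.isLift.deriv_pos x
    · rw [φ.coe_lift]; rfl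

/-- The Dirichlet energy `∫_𝕋 φ'(τ)² dτ`. -/
def energy (φ : CircleDiff) : ℝ := ∫ τ in (0 : ℝ)..1, deriv φ.lift τ ^ 2

end CircleDiff

/-- The Schwarzian derivative `f''' / f' - (3/2) (f'' / f')²`. -/
def schwarzian (f : ℝ → ℝ) (x : ℝ) : ℝ :=
  iteratedDeriv 3 f x / deriv f x - 3 / 2 * (iteratedDeriv 2 f x / deriv f x) ^ 2

/-- The logarithm of the density `dψ^*μ / dμ` at `φ`, for `a = α²`. -/
def orbitalExponent (σ a : ℝ) (ψ φ : CircleDiff) : ℝ :=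
  1 / σ ^ 2 * ∫ τ in (0 : ℝ)..1,
    (schwarzian ψ.lift (φ.lift τ) + 2 * a * (deriv ψ.lift (φ.lift τ) ^ 2 - 1))
      * deriv φ.lift τ ^ 2

/-- `μ` is an unquotiented Virasoro `α`-orbital measure, `a = α²`: a Radon measure on `Diff¹(𝕋)`
whose pull-back `ψ^*μ (A) = μ (ψ ∘ A)` under every `ψ ∈ Diff³(𝕋)` has the prescribed density. -/
structure IsOrbitalMeasure (σ a : ℝ) (μ : Measure CircleDiff) : Prop where
  locallyFinite : IsLocallyFiniteMeasure μ
  innerRegular : μ.InnerRegular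
  change_of_variables : ∀ ψ : CircleDiff, ψ.IsC3 → ∀ A : Set CircleDiff, MeasurableSet A →
    μ ((fun φ => ψ.comp φ) '' A)
      = ∫⁻ φ in A, ENNReal.ofReal (Real.exp (orbitalExponent σ a ψ φ)) ∂μ

/-- The family of measures generated by an orbital measure `μ` with parameter `a₀ = α₀²`:
the member with parameter `a = α²` has density `exp {2 (a - a₀) / σ² ∫ φ'²}` with respect
to `μ`. -/
def orbitalFamily (σ a₀ : ℝ) (μ : Measure CircleDiff) (a : ℝ) : Measure CircleDiff :=
  μ.withDensity fun φ => ENNReal.ofReal (Real.exp (2 * (a - a₀) / σ ^ 2 * φ.energy))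

/-- The map `φ ↦ φ - φ(t₀)`. -/
def pin (t₀ : UnitAddCircle) (φ : CircleDiff) : CircleDiff := φ.rotate (-φ t₀)

theorem CircleDiff.derivative_rotate (φ : CircleDiff) (θ : UnitAddCircle) :
    (φ.rotate θ).derivative = φ.derivative := by
  obtain ⟨c, rfl⟩ := QuotientAddGroup.mk_surjective θ
  have hint : ∀ x, ∃ n : ℤ, (φ.rotate (c : UnitAddCircle)).lift x - (φ.lift x + c) = n := by
    intro x
    have h : ((φ.rotate (c : UnitAddCircle)).lift x : UnitAddCircle)
        = ((φ.lift x + c : ℝ) : UnitAddCircle) := by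
      rw [← CircleDiff.coe_lift]
      change φ (x : UnitAddCircle) + (c : UnitAddCircle) = _
      rw [φ.coe_lift]; rfl
    have h2 := sub_eq_zero.mpr h
    rw [← AddCircle.coe_sub] at h2
    obtain ⟨n, hn⟩ := AddCircle.coe_eq_zero_iff (1 : ℝ) |>.mp h2
    exact ⟨n, by rw [← hn]; simp⟩
  choose n hn using hint
  have hcont : Continuous fun x => ((n x : ℤ) : ℝ) := by
    have : (fun x => ((n x : ℤ) : ℝ))
        = fun x => (φ.rotate (c : UnitAddCircle)).lift x - (φ.lift x + c) :=
      funext fun x => (hn x).symm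
    rw [this]
    exact (CircleDiff.isLift _).contDiff.continuous.sub
      (φ.isLift.contDiff.continuous.add continuous_const)
  have hn' : Continuous n := Int.isClosedEmbedding_coe_real.isEmbedding.continuous_iff.mpr hcont
  have hconst : ∀ x, n x = n 0 := fun x => (isPreconnected_univ (α := ℝ)).constant
    hn'.continuousOn (mem_univ x) (mem_univ 0)
  have hl : (φ.rotate (c : UnitAddCircle)).lift = fun x => φ.lift x + (c + n 0) := by
    funext x
    have := hn x
    rw [hconst x] at this
    linarith
  ext t
  obtain ⟨x, rfl⟩ := QuotientAddGroup.mk_surjective t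
  change deriv (φ.rotate (c : UnitAddCircle)).lift x = deriv φ.lift x
  rw [hl, deriv_add_const]

theorem continuous_pin (t₀ : UnitAddCircle) : Continuous (pin t₀) := by
  have h0 : Continuous fun φ : CircleDiff => (φ.toContinuousMap, φ.derivative) :=
    continuous_induced_dom
  refine continuous_induced_rng.mpr (Continuous.prodMk ?_ ?_)
  · have h1 : Continuous fun φ : CircleDiff => φ.toContinuousMap := h0.fst
    have h2 : Continuous fun φ : CircleDiff =>
        φ.toContinuousMap + ContinuousMap.const UnitAddCircle (-φ.toContinuousMap t₀) :=
      h1.add (ContinuousMap.continuous_const'.comp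
        ((continuous_eval_const (F := C(UnitAddCircle, UnitAddCircle)) t₀).comp h1).neg)
    exact h2
  · have h3 : (fun φ : CircleDiff => (pin t₀ φ).derivative) = fun φ => φ.derivative :=
      funext fun φ => φ.derivative_rotate _
    exact h3 ▸ h0.snd

/-- The measure pinned at `t₀`: the law of `φ - φ(t₀)` under `μ`
(`pin t₀` is measurable, being continuous). -/
def pinned (t₀ : UnitAddCircle) (μ : Measure CircleDiff) : Measure CircleDiff :=
  μ.map (pin t₀)

/-- The function `f_α`. For `α` real or purely imaginary with `α² < π²` and `t ∈ [0, 1]`,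
the complex number in the definition is real. -/
def fAlpha (α : ℂ) (t : ℝ) : ℝ :=
  if α = 0 then t
  else (1 / 2 * (1 / Complex.tan (α / 2) * Complex.tan (α * ((t : ℂ) - 1 / 2)) + 1)).re

/-- `α / sin α`, equal to `1` at `α = 0`; real for `α` real or purely imaginary. -/
def alphaDivSin (α : ℂ) : ℝ := if α = 0 then 1 else (α / Complex.sin α).re

/-- The defect coefficient `8 sin²(α/2)`; real for `α` real or purely imaginary. -/
def defectCoeff (α : ℂ) : ℝ := (8 * Complex.sin (α / 2) ^ 2).re

/-- `f ∈ Diff³[0, 1]`. -/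
structure IsIntervalDiff3 (f : ℝ → ℝ) : Prop where
  contDiffOn : ContDiffOn ℝ 3 f (Icc 0 1)
  map_zero : f 0 = 0
  map_one : f 1 = 1
  deriv_pos : ∀ t ∈ Icc (0 : ℝ) 1, 0 < derivWithin f (Icc 0 1) t

end

/-! Write `a = α²` and `u(x) = cos(α(x - 1/2))` on `[0, 1]`, extended periodically. Then `f_α' = c /
u²`, and a map with this derivative has Schwarzian `-2u''/u`. On the circle `u` has a kink at `0`,
so `f_α` is only `C¹` there, and in the sense of distributions `𝒮(f_α) = 2a - 4α tan(α/2) δ₀`. For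
`φ(t₀) = 0`, the integral `∫ 𝒮(f_α)(φ) φ'²` is therefore `Λ(φ) = 2a ∫ φ'² - 4α tan(α/2) φ'(t₀)`. The
energy term is the density of the `α`-measure relative to the `0`-measure. Since `(f_α ∘ φ)'(t₀) =
(α / sin α) φ'(t₀)`, the other term is the defect `-8 sin²(α/2) (f_α ∘ φ)'(t₀)`.

To justify this for a map outside `Diff³`, the orbital measure is first reweighted so that its
density is `exp(∫ 𝒮_ψ(φ) φ'² / σ²)` (`IsOrbitalMeasure.leftQuasiInvariant`). It is rotation
invariant, hence the product of its pinned law and Haar measure. Disintegrating shows that the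
pinned law is quasi-invariant under `x ↦ ψ(x + θ) - ψ(θ)` for almost every `θ`, with extra factor
`ψ'(θ)`, the Jacobian on the rotation coordinate (`ae_lintegral_recenter`). This factor becomes
`f_α'(0) = α / sin α`.

Finally `u` is smoothed to `uₙ`, with `δ₀` in `u''` replaced by a bump (`IsTrigPair.exists_approx`).
Along good `θₙ → 0`, Fatou's lemma on open sets gives one inequality for `f_α` and another for its
inverse; outer regularity extends both to all Borel sets, and together they give equality
(`lintegral_comp_of_tendsto`). -/

noncomputable section

open Filter Topology

/-! ### Lifts, composition, rotation and the `C¹` topology. -/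

namespace CircleDiff

theorem ext_apply {φ ψ : CircleDiff} (h : ∀ t, φ t = ψ t) : φ = ψ := by
  cases φ; cases ψ; congr; exact funext h

/-- Two continuous lifts of the same circle map differ by an integer. -/
theorem lift_eq_add_int (φ : CircleDiff) {g : ℝ → ℝ} (hg : Continuous g)
    (h : ∀ x : ℝ, φ (x : UnitAddCircle) = (g x : UnitAddCircle)) :
    ∃ n : ℤ, ∀ x, φ.lift x = g x + n := by
  have hint : ∀ x, ∃ n : ℤ, φ.lift x - g x = n := by
    intro x
    have h2 : ((φ.lift x : ℝ) : UnitAddCircle) = (g x : UnitAddCircle) := by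
      rw [← φ.coe_lift, h]
    have h2 := sub_eq_zero.mpr h2
    rw [← AddCircle.coe_sub] at h2
    obtain ⟨n, hn⟩ := AddCircle.coe_eq_zero_iff (1 : ℝ) |>.mp h2
    exact ⟨n, by rw [← hn]; simp⟩
  choose n hn using hint
  have hcont : Continuous fun x => ((n x : ℤ) : ℝ) := by
    rw [← funext hn]
    exact φ.isLift.contDiff.continuous.sub hg
  have hn' : Continuous n := Int.isClosedEmbedding_coe_real.isEmbedding.continuous_iff.mpr hcont
  refine ⟨n 0, fun x => ?_⟩
  have := (isPreconnected_univ (α := ℝ)).constant hn'.continuousOn (mem_univ x) (mem_univ 0)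
  have h3 := hn x
  rw [this] at h3
  linarith

/-- `lift` is an arbitrary choice; this frees derivative computations from it. -/
theorem deriv_lift_eq (φ : CircleDiff) {g : ℝ → ℝ} (hg : Continuous g)
    (h : ∀ x : ℝ, φ (x : UnitAddCircle) = (g x : UnitAddCircle)) :
    deriv φ.lift = deriv g := by
  obtain ⟨n, hn⟩ := φ.lift_eq_add_int hg h
  funext x
  rw [funext hn, deriv_add_const]

theorem derivative_coe (φ : CircleDiff) (x : ℝ) :
    φ.derivative (x : UnitAddCircle) = deriv φ.lift x := rfl

theorem derivative_pos (φ : CircleDiff) (t : UnitAddCircle) : 0 < φ.derivative t := by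
  obtain ⟨x, rfl⟩ := QuotientAddGroup.mk_surjective t
  exact φ.isLift.deriv_pos x

theorem hasDerivAt_lift (φ : CircleDiff) (x : ℝ) :
    HasDerivAt φ.lift (φ.derivative (x : UnitAddCircle)) x :=
  (φ.isLift.contDiff.differentiable one_ne_zero x).hasDerivAt

@[simp] theorem comp_apply (ψ φ : CircleDiff) (t : UnitAddCircle) : ψ.comp φ t = ψ (φ t) := rfl

@[simp] theorem rotate_apply (φ : CircleDiff) (θ t : UnitAddCircle) :
    φ.rotate θ t = φ t + θ := rfl

theorem derivative_comp (ψ φ : CircleDiff) (t : UnitAddCircle) :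
    (ψ.comp φ).derivative t = ψ.derivative (φ t) * φ.derivative t := by
  obtain ⟨x, rfl⟩ := QuotientAddGroup.mk_surjective t
  have h : deriv (ψ.comp φ).lift = deriv (ψ.lift ∘ φ.lift) :=
    (ψ.comp φ).deriv_lift_eq
      (ψ.isLift.contDiff.continuous.comp φ.isLift.contDiff.continuous) fun x => by
        simp only [comp_apply, Function.comp_apply, φ.coe_lift, ψ.coe_lift]
  change deriv (ψ.comp φ).lift x = ψ.derivative (φ (x : UnitAddCircle)) * deriv φ.lift x
  rw [h, deriv_comp x (ψ.isLift.contDiff.differentiable one_ne_zero _)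
        (φ.isLift.contDiff.differentiable one_ne_zero _), φ.coe_lift]
  rfl

theorem continuous_toContinuousMap : Continuous toContinuousMap :=
  (continuous_induced_dom (f := fun φ : CircleDiff => (φ.toContinuousMap, φ.derivative))).fst

theorem continuous_derivative : Continuous derivative :=
  (continuous_induced_dom (f := fun φ : CircleDiff => (φ.toContinuousMap, φ.derivative))).snd

theorem continuous_apply {Y : Type*} [TopologicalSpace Y] {F : Y → CircleDiff}
    {t : Y → UnitAddCircle} (hF : Continuous F) (ht : Continuous t) :
    Continuous fun y => F y (t y) :=
  (continuous_eval (F := C(UnitAddCircle, UnitAddCircle))).comp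
    ((continuous_toContinuousMap.comp hF).prodMk ht)

theorem continuous_derivative_apply {Y : Type*} [TopologicalSpace Y] {F : Y → CircleDiff}
    {t : Y → UnitAddCircle} (hF : Continuous F) (ht : Continuous t) :
    Continuous fun y => (F y).derivative (t y) :=
  (continuous_eval (F := C(UnitAddCircle, ℝ))).comp
    ((continuous_derivative.comp hF).prodMk ht)

/-- A map into `Diff¹(𝕋)` is continuous as soon as `(y, t) ↦ F y t` and `(y, t) ↦ (F y)' t` are. -/
theorem continuous_of_uncurry {Y : Type*} [TopologicalSpace Y] {F : Y → CircleDiff}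
    (h0 : Continuous fun p : Y × UnitAddCircle => F p.1 p.2)
    (h1 : Continuous fun p : Y × UnitAddCircle => (F p.1).derivative p.2) : Continuous F :=
  continuous_induced_rng.mpr <| Continuous.prodMk
    (ContinuousMap.continuous_of_continuous_uncurry _ h0)
    (ContinuousMap.continuous_of_continuous_uncurry _ h1)

theorem continuous_comp {Y : Type*} [TopologicalSpace Y] {F G : Y → CircleDiff}
    (hF : Continuous F) (hG : Continuous G) : Continuous fun y => (F y).comp (G y) := by
  have h : Continuous fun p : Y × UnitAddCircle => G p.1 p.2 :=
    continuous_apply (hG.comp continuous_fst) continuous_snd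
  refine continuous_of_uncurry ?_ ?_
  · simp only [comp_apply]
    exact continuous_apply (hF.comp continuous_fst) h
  simp only [derivative_comp]
  exact (continuous_derivative_apply (hF.comp continuous_fst) h).mul
    (continuous_derivative_apply (hG.comp continuous_fst) continuous_snd)

theorem continuous_rotate {Y : Type*} [TopologicalSpace Y] {F : Y → CircleDiff}
    {θ : Y → UnitAddCircle} (hF : Continuous F) (hθ : Continuous θ) :
    Continuous fun y => (F y).rotate (θ y) := by
  refine continuous_of_uncurry ?_ ?_
  · exact (continuous_apply (hF.comp continuous_fst) continuous_snd).add (hθ.comp continuous_fst)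
  · simp only [derivative_rotate]
    exact continuous_derivative_apply (hF.comp continuous_fst) continuous_snd

/-- With pseudometrizability below, this makes locally finite measures σ-finite and outer regular,
and continuous maps on products Borel measurable. -/
instance : SecondCountableTopology CircleDiff :=
  TopologicalSpace.secondCountableTopology_induced _ _ _

instance : TopologicalSpace.PseudoMetrizableSpace CircleDiff :=
  (Topology.IsInducing.mk rfl :
    Topology.IsInducing fun φ : CircleDiff => (φ.toContinuousMap, φ.derivative)).pseudoMetrizableSpace

/-- The circle diffeomorphism with a given lift. -/
def ofLift (g : ℝ → ℝ) (hg : IsCircleDiffLift g) : CircleDiff where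
  toFun := Function.Periodic.lift (f := fun x : ℝ => (g x : UnitAddCircle)) (c := (1 : ℝ))
    fun x => by
      change ((g (x + 1) : ℝ) : UnitAddCircle) = (g x : UnitAddCircle)
      rw [hg.map_add_one, AddCircle.coe_add_period]
  exists_lift := ⟨g, hg, fun _ => rfl⟩

theorem ofLift_coe {g : ℝ → ℝ} (hg : IsCircleDiffLift g) (x : ℝ) :
    ofLift g hg (x : UnitAddCircle) = (g x : UnitAddCircle) := rfl

theorem derivative_ofLift {g : ℝ → ℝ} (hg : IsCircleDiffLift g) (x : ℝ) :
    (ofLift g hg).derivative (x : UnitAddCircle) = deriv g x := by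
  rw [derivative_coe, (ofLift g hg).deriv_lift_eq hg.contDiff.continuous (ofLift_coe hg)]

end CircleDiff

/-! ### Inverse diffeomorphisms. -/

namespace IsCircleDiffLift

variable {g : ℝ → ℝ}

theorem strictMono (hg : IsCircleDiffLift g) : StrictMono g :=
  strictMono_of_deriv_pos hg.deriv_pos

theorem map_add_nat (hg : IsCircleDiffLift g) (n : ℕ) (x : ℝ) : g (x + n) = g x + n := by
  induction n with
  | zero => simp
  | succ k ih => push_cast; rw [← add_assoc, hg.map_add_one, ih]; ring

theorem surjective (hg : IsCircleDiffLift g) : Function.Surjective g := by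
  intro y
  obtain ⟨n, hn⟩ := exists_nat_ge |y - g 0|
  have hn := abs_le.mp hn
  have h1 : g n = g 0 + n := by simpa using hg.map_add_nat n 0
  have h2 : g (-n) = g 0 - n := by
    have := hg.map_add_nat n (-n)
    rw [neg_add_cancel] at this
    linarith
  have := intermediate_value_Icc (a := (-n : ℝ)) (b := n) (by linarith [n.cast_nonneg (α := ℝ)])
    hg.contDiff.continuous.continuousOn
  obtain ⟨x, -, hx⟩ := this (show y ∈ Icc (g (-n)) (g n) from ⟨by linarith, by linarith⟩)
  exact ⟨x, hx⟩

/-- A lift as a homeomorphism of the line. -/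
def homeo (hg : IsCircleDiffLift g) : ℝ ≃ₜ ℝ :=
  (hg.strictMono.orderIsoOfSurjective g hg.surjective).toHomeomorph

theorem homeo_apply (hg : IsCircleDiffLift g) (x : ℝ) : hg.homeo x = g x := rfl

theorem hasDerivAt (hg : IsCircleDiffLift g) (x : ℝ) : HasDerivAt g (deriv g x) x :=
  (hg.contDiff.differentiable one_ne_zero x).hasDerivAt

theorem homeo_symm (hg : IsCircleDiffLift g) : IsCircleDiffLift hg.homeo.symm where
  contDiff := hg.homeo.contDiff_symm_deriv (f' := deriv g) (fun x => (hg.deriv_pos x).ne')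
    hg.hasDerivAt hg.contDiff
  map_add_one x := by
    rw [Homeomorph.symm_apply_eq, hg.homeo_apply, hg.map_add_one, ← hg.homeo_apply,
      Homeomorph.apply_symm_apply]
  deriv_pos x := by
    have h := (hg.hasDerivAt (hg.homeo.symm x)).of_local_left_inverse (f := g)
      hg.homeo.symm.continuous.continuousAt (hg.deriv_pos _).ne'
      (Eventually.of_forall fun y => by
        rw [← hg.homeo_apply, Homeomorph.apply_symm_apply])
    rw [h.deriv]
    exact inv_pos.mpr (hg.deriv_pos _)

end IsCircleDiffLift

namespace CircleDiff

/-- The inverse diffeomorphism. -/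
def inv (φ : CircleDiff) : CircleDiff := ofLift _ φ.isLift.homeo_symm

@[simp] theorem apply_inv_apply (φ : CircleDiff) (t : UnitAddCircle) : φ (φ.inv t) = t := by
  obtain ⟨x, rfl⟩ := QuotientAddGroup.mk_surjective t
  rw [inv, ofLift_coe, coe_lift, ← φ.isLift.homeo_apply, Homeomorph.apply_symm_apply]

@[simp] theorem inv_apply_apply (φ : CircleDiff) (t : UnitAddCircle) : φ.inv (φ t) = t := by
  obtain ⟨x, rfl⟩ := QuotientAddGroup.mk_surjective t
  rw [coe_lift, inv, ofLift_coe, ← φ.isLift.homeo_apply, Homeomorph.symm_apply_apply]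

@[simp] theorem comp_inv_comp (φ χ : CircleDiff) : φ.comp (φ.inv.comp χ) = χ :=
  ext_apply fun t => by simp

@[simp] theorem inv_comp_comp (φ χ : CircleDiff) : φ.inv.comp (φ.comp χ) = χ :=
  ext_apply fun t => by simp

theorem derivative_inv (φ : CircleDiff) (t : UnitAddCircle) :
    φ.inv.derivative t = (φ.derivative (φ.inv t))⁻¹ := by
  have h := derivative_comp φ φ.inv t
  have h2 : (φ.comp φ.inv).derivative t = 1 := by
    obtain ⟨x, rfl⟩ := QuotientAddGroup.mk_surjective t
    have : deriv (φ.comp φ.inv).lift = deriv id :=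
      (φ.comp φ.inv).deriv_lift_eq continuous_id fun x => by simp
    change deriv (φ.comp φ.inv).lift x = 1
    rw [this, deriv_id]
  rw [h2] at h
  exact eq_inv_of_mul_eq_one_right h.symm

/-- A closed graph argument: the preimage of a closed `C` is the projection, along the compact
circle, of the closed set of `((φ, y), x)` with `φ x = y` and `x ∈ C`. -/
theorem continuous_inv_apply :
    Continuous fun p : CircleDiff × UnitAddCircle => p.1.inv p.2 := by
  rw [continuous_iff_isClosed]
  intro C hC
  have h1 : IsClosed {q : (CircleDiff × UnitAddCircle) × UnitAddCircle |
      q.1.1 q.2 = q.1.2 ∧ q.2 ∈ C} :=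
    (isClosed_eq (continuous_apply (continuous_fst.comp continuous_fst) continuous_snd)
      (continuous_snd.comp continuous_fst)).inter (hC.preimage continuous_snd)
  convert isClosedMap_fst_of_compactSpace _ h1 using 1
  ext ⟨φ, y⟩
  constructor
  · intro h
    exact ⟨((φ, y), φ.inv y), ⟨by simp, h⟩, rfl⟩
  · rintro ⟨⟨⟨φ', y'⟩, x⟩, ⟨h, hx⟩, h'⟩
    obtain ⟨rfl, rfl⟩ := Prod.mk.inj h'
    change φ' x = y' at h
    change φ'.inv y' ∈ C
    rw [← h, inv_apply_apply]
    exact hx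

theorem continuous_inv : Continuous inv := by
  refine continuous_of_uncurry continuous_inv_apply ?_
  simp only [derivative_inv]
  exact (continuous_derivative_apply continuous_fst continuous_inv_apply).inv₀
    fun p => (derivative_pos _ _).ne'

end CircleDiff

/-! ### The functionals `∫ s(φ) φ'²` and substitution on the circle. -/

namespace CircleDiff

/-- The quantity `∫_𝕋 s(φ(τ)) φ'(τ)² dτ`. -/
def pairing (s : C(UnitAddCircle, ℝ)) (φ : CircleDiff) : ℝ :=
  ∫ τ in (0 : ℝ)..1, s (φ (τ : UnitAddCircle)) * φ.derivative (τ : UnitAddCircle) ^ 2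

theorem continuous_coe_circle : Continuous fun x : ℝ => (x : UnitAddCircle) :=
  AddCircle.continuous_mk' (1 : ℝ)

theorem continuous_pairing {Y : Type*} [TopologicalSpace Y] {s : Y → C(UnitAddCircle, ℝ)}
    {F : Y → CircleDiff} (hs : Continuous s) (hF : Continuous F) :
    Continuous fun y => pairing (s y) (F y) := by
  refine intervalIntegral.continuous_parametric_intervalIntegral_of_continuous' ?_ _ _
  have hF' : Continuous fun p : Y × ℝ => F p.1 := hF.comp continuous_fst
  have ht : Continuous fun p : Y × ℝ => (p.2 : UnitAddCircle) :=
    continuous_coe_circle.comp continuous_snd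
  have h1 : Continuous fun p : Y × ℝ => s p.1 (F p.1 p.2) :=
    (continuous_eval (F := C(UnitAddCircle, ℝ))).comp
      ((hs.comp continuous_fst).prodMk (continuous_apply hF' ht))
  exact h1.mul ((continuous_derivative_apply hF' ht).pow 2)

theorem continuous_pairing_integrand (s : C(UnitAddCircle, ℝ)) (φ : CircleDiff) :
    Continuous fun τ : ℝ => s (φ (τ : UnitAddCircle)) * φ.derivative (τ : UnitAddCircle) ^ 2 :=
  (s.continuous.comp (φ.continuous_toFun.comp continuous_coe_circle)).mul
    ((φ.derivative.continuous.comp continuous_coe_circle).pow 2)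

theorem pairing_add (s r : C(UnitAddCircle, ℝ)) (φ : CircleDiff) :
    pairing (s + r) φ = pairing s φ + pairing r φ := by
  rw [pairing, pairing, pairing, ← intervalIntegral.integral_add
    ((continuous_pairing_integrand s φ).intervalIntegrable _ _)
    ((continuous_pairing_integrand r φ).intervalIntegrable _ _)]
  simp only [ContinuousMap.add_apply, add_mul]

theorem pairing_smul (c : ℝ) (s : C(UnitAddCircle, ℝ)) (φ : CircleDiff) :
    pairing (c • s) φ = c * pairing s φ := by
  rw [pairing, pairing, ← intervalIntegral.integral_const_mul]
  simp only [ContinuousMap.smul_apply, smul_eq_mul, mul_assoc]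

theorem pairing_one (φ : CircleDiff) : pairing 1 φ = φ.energy := by
  simp only [pairing, energy, ContinuousMap.one_apply, one_mul, derivative_coe]

theorem energy_comp (ψ φ : CircleDiff) :
    (ψ.comp φ).energy = pairing (ψ.derivative ^ 2) φ := by
  rw [← pairing_one]
  simp only [pairing, derivative_comp, ContinuousMap.one_apply, one_mul, ContinuousMap.pow_apply,
    mul_pow]

theorem continuous_energy : Continuous energy := by
  have h : energy = fun φ => pairing 1 φ := funext fun φ => (pairing_one φ).symm
  rw [h]
  exact continuous_pairing continuous_const continuous_id

theorem energy_rotate (φ : CircleDiff) (θ : UnitAddCircle) : (φ.rotate θ).energy = φ.energy := by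
  simp only [energy, ← derivative_coe, derivative_rotate]

/-- Substitution `x = φ(τ)` on the circle. -/
theorem integral_comp_mul_derivative (φ : CircleDiff) (w : C(UnitAddCircle, ℝ)) :
    ∫ τ in (0 : ℝ)..1, w (φ (τ : UnitAddCircle)) * φ.derivative (τ : UnitAddCircle)
      = ∫ x in (0 : ℝ)..1, w (x : UnitAddCircle) := by
  have hw : Continuous fun x : ℝ => w (x : UnitAddCircle) :=
    w.continuous.comp continuous_coe_circle
  have h := intervalIntegral.integral_comp_mul_deriv (a := 0) (b := 1) (f := φ.lift)
    (f' := fun τ => φ.derivative (τ : UnitAddCircle)) (g := fun x : ℝ => w (x : UnitAddCircle))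
    (fun x _ => φ.hasDerivAt_lift x)
    (φ.derivative.continuous.comp continuous_coe_circle).continuousOn hw
  have hp : Function.Periodic (fun x : ℝ => w (x : UnitAddCircle)) 1 := fun x => by
    simp only [AddCircle.coe_add_period]
  simp only [Function.comp_apply, ← φ.coe_lift] at h
  have h1 : φ.lift 1 = φ.lift 0 + 1 := by simpa using φ.isLift.map_add_one 0
  rw [h, h1, hp.intervalIntegral_add_eq (φ.lift 0) 0, zero_add]

/-- Substituting `x = φ(τ)` absorbs one of the two factors `φ'`. In this form `s` can tend to a
Dirac mass at `0`, and the limit is `φ'(φ⁻¹(0))`. -/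
theorem pairing_eq_integral (s : C(UnitAddCircle, ℝ)) (φ : CircleDiff) :
    pairing s φ
      = ∫ x in (0 : ℝ)..1, s (x : UnitAddCircle) * φ.derivative (φ.inv (x : UnitAddCircle)) := by
  have h := integral_comp_mul_derivative φ
    (s * φ.derivative.comp φ.inv.toContinuousMap)
  have e (t : UnitAddCircle) : (φ.derivative.comp φ.inv.toContinuousMap) t
    = φ.derivative (φ.inv t) := rfl
  simp only [ContinuousMap.mul_apply, e, inv_apply_apply] at h
  rw [← h, pairing]
  simp only [pow_two, mul_assoc]

theorem lintegral_comp_mul_derivative (φ : CircleDiff) (w : UnitAddCircle → ℝ≥0∞) :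
    ∫⁻ t, ENNReal.ofReal (φ.derivative t) * w (φ t) = ∫⁻ t, w t := by
  rw [← UnitAddCircle.lintegral_preimage (φ.lift 0) w,
    ← UnitAddCircle.lintegral_preimage 0 fun t => ENNReal.ofReal (φ.derivative t) * w (φ t)]
  have himg : φ.lift '' Ioc 0 (0 + 1) = Ioc (φ.lift 0) (φ.lift 0 + 1) := by
    rw [← φ.isLift.map_add_one]
    exact (φ.isLift.strictMono.orderIsoOfSurjective _ φ.isLift.surjective).image_Ioc 0 (0 + 1)
  rw [← himg, lintegral_image_eq_lintegral_abs_deriv_mul measurableSet_Ioc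
    (fun x _ => (φ.hasDerivAt_lift x).hasDerivWithinAt) φ.isLift.strictMono.injective.injOn]
  simp only [← φ.coe_lift, abs_of_pos (φ.derivative_pos _)]

theorem lintegral_comp_inv (φ : CircleDiff) (w : UnitAddCircle → ℝ≥0∞) :
    ∫⁻ t, w (φ.inv t) = ∫⁻ t, ENNReal.ofReal (φ.derivative t) * w t := by
  rw [← lintegral_comp_mul_derivative φ]
  simp only [inv_apply_apply]

/-! ### Diffeomorphisms prescribed by their derivative. -/

section OfDensity

/-- The space of continuous positive probability densities on the circle. -/
abbrev PosDensity : Type :=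
  {h : C(UnitAddCircle, ℝ) // (∀ t, 0 < h t) ∧ ∫ x in (0 : ℝ)..1, h (x : UnitAddCircle) = 1}

theorem hasDerivAt_integral_coe (h : C(UnitAddCircle, ℝ)) (x : ℝ) :
    HasDerivAt (fun y : ℝ => ∫ τ in (0 : ℝ)..y, h (τ : UnitAddCircle)) (h (x : UnitAddCircle)) x :=
  ((h.continuous.comp continuous_coe_circle).integral_hasStrictDerivAt 0 x).hasDerivAt

theorem integral_coe_add_one (h : C(UnitAddCircle, ℝ)) (x : ℝ) :
    ∫ τ in (0 : ℝ)..(x + 1), h (τ : UnitAddCircle)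
      = (∫ τ in (0 : ℝ)..x, h (τ : UnitAddCircle)) + ∫ τ in (0 : ℝ)..1, h (τ : UnitAddCircle) := by
  have hp : Function.Periodic (fun x : ℝ => h (x : UnitAddCircle)) 1 := fun x => by
    simp only [AddCircle.coe_add_period]
  have hc : Continuous fun x : ℝ => h (x : UnitAddCircle) :=
    h.continuous.comp continuous_coe_circle
  rw [← intervalIntegral.integral_add_adjacent_intervals (hc.intervalIntegrable 0 x)
    (hc.intervalIntegrable x (x + 1)), hp.intervalIntegral_add_eq x 0, zero_add]

theorem isCircleDiffLift_integral (h : PosDensity) :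
    IsCircleDiffLift fun y : ℝ => ∫ τ in (0 : ℝ)..y, h.1 (τ : UnitAddCircle) := by
  have hd : (deriv fun y : ℝ => ∫ τ in (0 : ℝ)..y, h.1 (τ : UnitAddCircle))
      = fun x : ℝ => h.1 (x : UnitAddCircle) :=
    funext fun x => (hasDerivAt_integral_coe h.1 x).deriv
  refine ⟨?_, fun x => ?_, fun x => ?_⟩
  · rw [contDiff_one_iff_deriv, hd]
    exact ⟨fun x => (hasDerivAt_integral_coe h.1 x).differentiableAt,
      h.1.continuous.comp continuous_coe_circle⟩
  · rw [integral_coe_add_one, h.2.2]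
  · rw [hd]
    exact h.2.1 _

/-- The diffeomorphism fixing `0` with derivative `h`. -/
def ofDensity (h : PosDensity) : CircleDiff := ofLift _ (isCircleDiffLift_integral h)

theorem ofDensity_coe (h : PosDensity) (x : ℝ) : ofDensity h (x : UnitAddCircle)
    = ((∫ τ in (0 : ℝ)..x, h.1 (τ : UnitAddCircle) : ℝ) : UnitAddCircle) := rfl

theorem ofDensity_zero (h : PosDensity) : ofDensity h 0 = 0 := by
  have := ofDensity_coe h 0
  simpa using this

theorem derivative_ofDensity (h : PosDensity) : (ofDensity h).derivative = h.1 := by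
  ext t
  obtain ⟨x, rfl⟩ := QuotientAddGroup.mk_surjective t
  exact (derivative_ofLift _ x).trans (hasDerivAt_integral_coe h.1 x).deriv

theorem continuous_ofDensity : Continuous ofDensity := by
  refine continuous_of_uncurry ?_ ?_
  · have hq : IsOpenQuotientMap fun x : ℝ => (x : UnitAddCircle) :=
      QuotientAddGroup.isOpenQuotientMap_mk
    -- Joint continuity may be tested on the real line: the covering map is an open quotient map,
    -- and this property survives products with the identity.
    refine ((IsOpenQuotientMap.id (X := PosDensity)).prodMap hq).isQuotientMap.continuous_iff.mpr ?_
    change Continuous fun p : PosDensity × ℝ =>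
      ((∫ τ in (0 : ℝ)..p.2, p.1.1 (τ : UnitAddCircle) : ℝ) : UnitAddCircle)
    refine continuous_coe_circle.comp
      (intervalIntegral.continuous_parametric_primitive_of_continuous
        (f := fun (h : PosDensity) (τ : ℝ) => h.1 (τ : UnitAddCircle)) ?_)
    exact (continuous_eval (F := C(UnitAddCircle, ℝ))).comp
      ((continuous_subtype_val.comp continuous_fst).prodMk
        (continuous_coe_circle.comp continuous_snd))
  · simp only [derivative_ofDensity]
    exact (continuous_eval (F := C(UnitAddCircle, ℝ))).comp
      ((continuous_subtype_val.comp continuous_fst).prodMk continuous_snd)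

end OfDensity

end CircleDiff

/-! ### Reduction to the density of a `0`-orbital measure. -/

namespace CircleDiff

/-- By the chain rule the `a`-dependent part is a coboundary of the energy, so it can be removed by
reweighting the measure. -/
theorem orbitalExponent_eq (σ a : ℝ) (ψ φ : CircleDiff) (s : C(UnitAddCircle, ℝ))
    (hs : ∀ x : ℝ, schwarzian ψ.lift x = s (x : UnitAddCircle)) :
    orbitalExponent σ a ψ φ
      = pairing s φ / σ ^ 2 + 2 * a / σ ^ 2 * ((ψ.comp φ).energy - φ.energy) := by
  have h : pairing (s + (2 * a) • (ψ.derivative ^ 2 + (-1 : ℝ) • 1)) φ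
      = ∫ τ in (0 : ℝ)..1,
        (schwarzian ψ.lift (φ.lift τ) + 2 * a * (deriv ψ.lift (φ.lift τ) ^ 2 - 1))
          * deriv φ.lift τ ^ 2 := by
    rw [pairing]
    refine intervalIntegral.integral_congr fun τ _ => ?_
    simp only [hs, ← derivative_coe, ← φ.coe_lift, ContinuousMap.add_apply,
      ContinuousMap.smul_apply, ContinuousMap.pow_apply, ContinuousMap.one_apply, smul_eq_mul]
    ring
  rw [orbitalExponent, ← h, pairing_add, pairing_smul, pairing_add, pairing_smul, pairing_one,
    energy_comp]
  ring

end CircleDiff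

open CircleDiff

theorem IsOrbitalMeasure.lintegral_comp {σ a : ℝ} {μ : Measure CircleDiff}
    (hμ : IsOrbitalMeasure σ a μ) {ψ : CircleDiff} (hψ : ψ.IsC3) {s : C(UnitAddCircle, ℝ)}
    (hs : ∀ x : ℝ, schwarzian ψ.lift x = s (x : UnitAddCircle))
    {H : CircleDiff → ℝ≥0∞} (hH : Measurable H) :
    ∫⁻ φ, H φ ∂μ = ∫⁻ φ, ENNReal.ofReal (Real.exp (orbitalExponent σ a ψ φ)) * H (ψ.comp φ) ∂μ := by
  have hc : Continuous fun φ => ψ.comp φ := continuous_comp continuous_const continuous_id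
  have hD : Measurable fun φ => ENNReal.ofReal (Real.exp (orbitalExponent σ a ψ φ)) := by
    simp only [fun φ => orbitalExponent_eq σ a ψ φ s hs]
    refine (ENNReal.continuous_ofReal.comp (Real.continuous_exp.comp ?_)).measurable
    exact ((continuous_pairing continuous_const continuous_id).div_const _).add
      (continuous_const.mul ((continuous_energy.comp hc).sub continuous_energy))
  have hmap : μ = (μ.withDensity fun φ =>
      ENNReal.ofReal (Real.exp (orbitalExponent σ a ψ φ))).map fun φ => ψ.comp φ := by
    ext A hA
    -- The prescribed formula concerns images `ψ ∘ A`. Since `ψ ∘ ·` is onto, applying it to the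
    -- preimage of `A` gives a statement about a pushforward.
    rw [Measure.map_apply hc.measurable hA, withDensity_apply _ (hc.measurable hA),
      ← hμ.change_of_variables ψ hψ _ (hc.measurable hA), image_preimage_eq]
    exact fun χ => ⟨ψ.inv.comp χ, by simp⟩
  conv_lhs => rw [hmap]
  have hHc : Measurable fun φ => H (ψ.comp φ) := hH.comp hc.measurable
  rw [lintegral_map hH hc.measurable, lintegral_withDensity_eq_lintegral_mul _ hD hHc]
  rfl

/-- Quasi-invariance under the action of `Diff³(𝕋)` from the left with the density of a
`0`-orbital measure. -/
def LeftQuasiInvariant (σ : ℝ) (ν : Measure CircleDiff) : Prop :=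
  ∀ (ψ : CircleDiff) (s : C(UnitAddCircle, ℝ)), ψ.IsC3 →
    (∀ x : ℝ, schwarzian ψ.lift x = s (x : UnitAddCircle)) →
    ∀ H : CircleDiff → ℝ≥0∞, Measurable H →
      ∫⁻ φ, H φ ∂ν = ∫⁻ φ, ENNReal.ofReal (Real.exp (pairing s φ / σ ^ 2)) * H (ψ.comp φ) ∂ν

theorem measurable_ofReal_exp {X : Type*} [TopologicalSpace X] [MeasurableSpace X]
    [OpensMeasurableSpace X] {F : X → ℝ} (hF : Continuous F) :
    Measurable fun x => ENNReal.ofReal (Real.exp (F x)) :=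
  (ENNReal.continuous_ofReal.comp (Real.continuous_exp.comp hF)).measurable

/-- The weight `exp(-2 a₀ energy / σ²)` cancels the energy coboundary in the density, leaving only
the Schwarzian term. -/
theorem IsOrbitalMeasure.leftQuasiInvariant {σ a₀ : ℝ} {μ : Measure CircleDiff}
    (hμ : IsOrbitalMeasure σ a₀ μ) : LeftQuasiInvariant σ (orbitalFamily σ a₀ μ 0) := by
  intro ψ s hψ hs H hH
  have hc : Continuous fun φ => ψ.comp φ := continuous_comp continuous_const continuous_id
  have hE : Measurable fun φ : CircleDiff =>
      ENNReal.ofReal (Real.exp (2 * (0 - a₀) / σ ^ 2 * φ.energy)) :=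
    measurable_ofReal_exp (continuous_const.mul continuous_energy)
  have hP : Measurable fun φ : CircleDiff =>
      ENNReal.ofReal (Real.exp (pairing s φ / σ ^ 2)) :=
    measurable_ofReal_exp ((continuous_pairing continuous_const continuous_id).div_const _)
  have hHc : Measurable fun φ =>
      ENNReal.ofReal (Real.exp (pairing s φ / σ ^ 2)) * H (ψ.comp φ) :=
    hP.mul (hH.comp hc.measurable)
  rw [orbitalFamily, lintegral_withDensity_eq_lintegral_mul _ hE hH,
    lintegral_withDensity_eq_lintegral_mul _ hE hHc,
    hμ.lintegral_comp hψ hs (hE.mul hH)]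
  refine lintegral_congr fun φ => ?_
  simp only [Pi.mul_apply, ← mul_assoc, orbitalExponent_eq σ a₀ ψ φ s hs,
    ← ENNReal.ofReal_mul (Real.exp_pos _).le, ← Real.exp_add]
  congr 3
  ring

/-! ### Rotation invariance and disintegration over the pinned measure. -/

namespace CircleDiff

theorem isCircleDiffLift_id : IsCircleDiffLift id :=
  ⟨contDiff_id, fun _ => rfl, fun x => by simp⟩

/-- The identity of the circle. -/
def one : CircleDiff := ofLift id isCircleDiffLift_id

@[simp] theorem one_apply (t : UnitAddCircle) : one t = t := by
  obtain ⟨x, rfl⟩ := QuotientAddGroup.mk_surjective t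
  rfl

theorem one_rotate_comp (θ : UnitAddCircle) (φ : CircleDiff) :
    (one.rotate θ).comp φ = φ.rotate θ := ext_apply fun t => by simp

theorem exists_lift_one_rotate (θ : UnitAddCircle) :
    ∃ c : ℝ, (one.rotate θ).lift = fun x => x + c := by
  obtain ⟨c, rfl⟩ := QuotientAddGroup.mk_surjective θ
  obtain ⟨n, hn⟩ := (one.rotate (c : UnitAddCircle)).lift_eq_add_int
    (g := fun x => x + c) (by fun_prop) fun x => by simp
  exact ⟨c + n, funext fun x => by rw [hn]; ring⟩

end CircleDiff

namespace LeftQuasiInvariant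

variable {σ : ℝ} {ν : Measure CircleDiff}

/-- A rotation lifts to a translation, which has zero Schwarzian, so the density is `1`. -/
theorem lintegral_rotate (hν : LeftQuasiInvariant σ ν) (θ : UnitAddCircle)
    {H : CircleDiff → ℝ≥0∞} (hH : Measurable H) :
    ∫⁻ φ, H (φ.rotate θ) ∂ν = ∫⁻ φ, H φ ∂ν := by
  obtain ⟨c, hc⟩ := exists_lift_one_rotate θ
  have h1 : deriv (fun x : ℝ => x + c) = fun _ => 1 := by
    funext x; simp
  have h2 : iteratedDeriv 2 (fun x : ℝ => x + c) = fun _ => 0 := by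
    rw [iteratedDeriv_succ, iteratedDeriv_one, h1]; funext x; simp
  have h3 : iteratedDeriv 3 (fun x : ℝ => x + c) = fun _ => 0 := by
    rw [iteratedDeriv_succ, h2]; funext x; simp
  rw [hν (one.rotate θ) 0 (by rw [IsC3, hc]; fun_prop) (fun x => by
    simp [schwarzian, hc, h2, h3]) H hH]
  simp [one_rotate_comp, pairing]

end LeftQuasiInvariant

theorem pin_rotate_of_apply_eq_zero {t₀ : UnitAddCircle} {φ : CircleDiff} (h : φ t₀ = 0)
    (θ : UnitAddCircle) : pin t₀ (φ.rotate θ) = φ := ext_apply fun t => by simp [pin, h]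

theorem pin_apply_self (t₀ : UnitAddCircle) (φ : CircleDiff) : pin t₀ φ t₀ = 0 := by simp [pin]

theorem ae_pinned_apply_eq_zero (t₀ : UnitAddCircle) (ν : Measure CircleDiff) :
    ∀ᵐ φ ∂(pinned t₀ ν), φ t₀ = 0 := by
  rw [pinned, ae_map_iff (continuous_pin t₀).measurable.aemeasurable]
  · exact Eventually.of_forall (pin_apply_self t₀)
  · exact (isClosed_eq (continuous_apply continuous_id continuous_const)
      continuous_const).measurableSet

namespace LeftQuasiInvariant

variable {σ : ℝ} {ν : Measure CircleDiff}

theorem measurable_rotate : Measurable fun p : CircleDiff × UnitAddCircle => p.1.rotate p.2 :=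
  (continuous_rotate continuous_fst continuous_snd).measurable

/-- Disintegration of a rotation invariant measure along `φ ↦ φ - φ(t₀)`. -/
theorem lintegral_eq_pinned [SFinite ν] (hν : LeftQuasiInvariant σ ν) (t₀ : UnitAddCircle)
    {W : CircleDiff → ℝ≥0∞} (hW : Measurable W) :
    ∫⁻ φ, W φ ∂ν = ∫⁻ φ, (∫⁻ θ, W (φ.rotate θ)) ∂(pinned t₀ ν) := by
  have hm : Measurable fun p : CircleDiff × UnitAddCircle => W (p.1.rotate p.2) :=
    hW.comp measurable_rotate
  rw [pinned, lintegral_map hm.lintegral_prod_right' (continuous_pin t₀).measurable]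
  -- Pinning shifts the angle by `-φ(t₀)`, which Haar measure does not see.
  have h1 (φ : CircleDiff) : ∫⁻ θ, W ((pin t₀ φ).rotate θ) = ∫⁻ θ, W (φ.rotate θ) := by
    rw [← lintegral_add_left_eq_self (fun θ => W (φ.rotate θ)) (-φ t₀)]
    refine lintegral_congr fun θ => congrArg W (ext_apply fun t => ?_)
    simp [pin, add_assoc]
  simp only [h1]
  -- After the swap the inner integral does not depend on `θ`, and the circle has mass `1`.
  rw [lintegral_lintegral_swap hm.aemeasurable]
  simp only [hν.lintegral_rotate _ hW, lintegral_const, UnitAddCircle.measure_univ, mul_one]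

end LeftQuasiInvariant

/-! ### Quasi-invariance of the pinned measure under recentred diffeomorphisms. -/

namespace CircleDiff

/-- The diffeomorphism `x ↦ ψ(x + θ) - ψ(θ)`. -/
def recenter (ψ : CircleDiff) (θ : UnitAddCircle) : CircleDiff :=
  (ψ.comp (one.rotate θ)).rotate (-ψ θ)

theorem recenter_apply (ψ : CircleDiff) (θ t : UnitAddCircle) :
    ψ.recenter θ t = ψ (t + θ) - ψ θ := by simp [recenter, sub_eq_add_neg]

theorem continuous_recenter {Y : Type*} [TopologicalSpace Y] {F : Y → CircleDiff}
    {θ : Y → UnitAddCircle} (hF : Continuous F) (hθ : Continuous θ) :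
    Continuous fun y => (F y).recenter (θ y) :=
  continuous_rotate (continuous_comp hF (continuous_rotate continuous_const hθ))
    (continuous_apply hF hθ).neg

theorem recenter_zero {ψ : CircleDiff} (h : ψ 0 = 0) : ψ.recenter 0 = ψ :=
  ext_apply fun t => by simp [recenter_apply, h]

end CircleDiff

theorem lintegral_lintegral_mul_swap {X Y : Type*} [MeasurableSpace X] [MeasurableSpace Y]
    {μ : Measure X} {ν : Measure Y} [SFinite μ] [SFinite ν] {g : X → ℝ≥0∞} (hg : Measurable g)
    {F : X × Y → ℝ≥0∞} (hF : Measurable F) :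
    ∫⁻ y, (∫⁻ x, g x * F (x, y) ∂μ) ∂ν = ∫⁻ x, g x * (∫⁻ y, F (x, y) ∂ν) ∂μ := by
  have h : Measurable fun p : Y × X => g p.2 * F (p.2, p.1) :=
    (hg.comp measurable_snd).mul (hF.comp measurable_swap)
  rw [lintegral_lintegral_swap h.aemeasurable]
  exact lintegral_congr fun x => lintegral_const_mul _ (hF.comp measurable_prodMk_left)

namespace LeftQuasiInvariant

variable {σ : ℝ} {ν : Measure CircleDiff}

/-- Quasi-invariance of the pinned measure under `x ↦ ψ(x + θ) - ψ(θ)`, for almost every `θ`. -/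
theorem ae_lintegral_recenter [SFinite ν] (hν : LeftQuasiInvariant σ ν) (t₀ : UnitAddCircle)
    {ψ : CircleDiff} (hψ : ψ.IsC3) {s : C(UnitAddCircle, ℝ)}
    (hs : ∀ x : ℝ, schwarzian ψ.lift x = s (x : UnitAddCircle))
    {K : UnitAddCircle × CircleDiff → ℝ≥0∞} (hK : Measurable K) :
    ∀ᵐ θ : UnitAddCircle, ENNReal.ofReal (ψ.derivative θ) * ∫⁻ φ, K (θ, φ) ∂(pinned t₀ ν)
      = ∫⁻ φ, ENNReal.ofReal (Real.exp (pairing s (φ.rotate θ) / σ ^ 2))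
          * K (θ, (ψ.recenter θ).comp φ) ∂(pinned t₀ ν) := by
  have : SFinite (pinned t₀ ν) := by unfold pinned; infer_instance
  have hψd : Measurable fun θ => ENNReal.ofReal (ψ.derivative θ) :=
    ENNReal.measurable_ofReal.comp ψ.derivative.continuous.measurable
  have hrot : Continuous fun p : UnitAddCircle × CircleDiff => p.2.rotate p.1 :=
    continuous_rotate continuous_snd continuous_fst
  have hexp : Measurable fun p : UnitAddCircle × CircleDiff =>
      ENNReal.ofReal (Real.exp (pairing s (p.2.rotate p.1) / σ ^ 2)) :=
    measurable_ofReal_exp ((continuous_pairing continuous_const hrot).div_const _)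
  have hrec : Continuous fun p : UnitAddCircle × CircleDiff => (ψ.recenter p.1).comp p.2 :=
    continuous_comp (continuous_recenter continuous_const continuous_fst) continuous_snd
  have hR : Measurable fun p : UnitAddCircle × CircleDiff =>
      ENNReal.ofReal (Real.exp (pairing s (p.2.rotate p.1) / σ ^ 2))
          * K (p.1, (ψ.recenter p.1).comp p.2) :=
    hexp.mul (hK.comp (measurable_fst.prodMk hrec.measurable))
  -- The almost everywhere identity is obtained by integrating over arbitrary measurable sets `A` of
  -- angles.
  refine ae_eq_of_forall_setLIntegral_eq_of_sigmaFinite (hψd.mul hK.lintegral_prod_right')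
    hR.lintegral_prod_right' fun A hA _ => ?_
  set I : UnitAddCircle → ℝ≥0∞ := A.indicator 1 with hI
  have hIm : Measurable I := measurable_one.indicator hA
  have hev : Continuous fun φ : CircleDiff => ψ.inv (φ t₀) :=
    continuous_apply continuous_const (continuous_apply continuous_id continuous_const)
  -- The argument `ψ⁻¹(φ(t₀))` is chosen so that on `ψ ∘ (φ + θ)` with `φ(t₀) = 0` it equals `θ`. On
  -- `φ + θ` it equals `ψ⁻¹(θ)`, and undoing this substitution produces the factor `ψ'(θ)`.
  set W : CircleDiff → ℝ≥0∞ := fun φ => I (ψ.inv (φ t₀)) * K (ψ.inv (φ t₀), pin t₀ φ) with hWdef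
  have hW : Measurable W := (hIm.comp hev.measurable).mul
    (hK.comp (hev.measurable.prodMk (continuous_pin t₀).measurable))
  have hWψ : Measurable fun φ => ENNReal.ofReal (Real.exp (pairing s φ / σ ^ 2))
      * W (ψ.comp φ) :=
    (measurable_ofReal_exp ((continuous_pairing continuous_const continuous_id).div_const _)).mul
      (hW.comp (continuous_comp continuous_const continuous_id).measurable)
  have key := hν ψ s hψ hs W hW
  rw [hν.lintegral_eq_pinned t₀ hW, hν.lintegral_eq_pinned t₀ hWψ] at key
  have hleft : ∫⁻ φ, (∫⁻ θ, W (φ.rotate θ)) ∂(pinned t₀ ν)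
      = ∫⁻ φ, (∫⁻ θ, I θ * (ENNReal.ofReal (ψ.derivative θ) * K (θ, φ))) ∂(pinned t₀ ν) := by
    refine lintegral_congr_ae ((ae_pinned_apply_eq_zero t₀ ν).mono fun φ hφ => ?_)
    simp only [hWdef, rotate_apply, hφ, zero_add, pin_rotate_of_apply_eq_zero hφ]
    rw [ψ.lintegral_comp_inv fun θ => I θ * K (θ, φ)]
    exact lintegral_congr fun θ => by ring
  have hright : ∫⁻ φ, (∫⁻ θ, ENNReal.ofReal (Real.exp (pairing s (φ.rotate θ) / σ ^ 2))
      * W (ψ.comp (φ.rotate θ))) ∂(pinned t₀ ν)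
      = ∫⁻ φ, (∫⁻ θ, I θ * (ENNReal.ofReal (Real.exp (pairing s (φ.rotate θ) / σ ^ 2))
          * K (θ, (ψ.recenter θ).comp φ))) ∂(pinned t₀ ν) := by
    refine lintegral_congr_ae ((ae_pinned_apply_eq_zero t₀ ν).mono fun φ hφ => ?_)
    refine lintegral_congr fun θ => ?_
    have hp : pin t₀ (ψ.comp (φ.rotate θ)) = (ψ.recenter θ).comp φ := ext_apply fun t => by
      simp [pin, recenter_apply, hφ, sub_eq_add_neg]
    simp only [hWdef, hp, comp_apply, rotate_apply, hφ, zero_add, inv_apply_apply]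
    ring
  rw [hleft, hright] at key
  have hL : Measurable fun p : UnitAddCircle × CircleDiff =>
      ENNReal.ofReal (ψ.derivative p.1) * K p := (hψd.comp measurable_fst).mul hK
  rw [lintegral_lintegral_mul_swap hIm hL, lintegral_lintegral_mul_swap hIm hR] at key
  have hKθ (θ : UnitAddCircle) : Measurable fun φ => K (θ, φ) := hK.comp measurable_prodMk_left
  simp only [lintegral_const_mul _ (hKθ _)] at key
  have hind (F : UnitAddCircle → ℝ≥0∞) : ∫⁻ θ in A, F θ = ∫⁻ θ, I θ * F θ := by
    rw [← lintegral_indicator hA]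
    refine lintegral_congr fun θ => ?_
    by_cases h : θ ∈ A <;> simp [hI, h]
  rw [hind, hind]
  exact key

end LeftQuasiInvariant

/-! ### Passage to `C¹`-limits. -/

/-- The rotation orbit of `φ` is compact, so it lies in an open set `W` of finite measure. By the
tube lemma, diffeomorphisms whose whole orbit stays in `W` form a neighbourhood of `φ`, and its
preimage under pinning lies in `W`. -/
theorem isLocallyFiniteMeasure_pinned (t₀ : UnitAddCircle) (ν : Measure CircleDiff)
    [IsLocallyFiniteMeasure ν] : IsLocallyFiniteMeasure (pinned t₀ ν) := by
  refine ⟨fun φ => ?_⟩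
  have hc : IsCompact (range fun θ => φ.rotate θ) :=
    isCompact_range (continuous_rotate continuous_const continuous_id)
  obtain ⟨W, hW, hWo, hWf⟩ := hc.exists_open_superset_measure_lt_top ν
  have ho : IsOpen {χ : CircleDiff | ∀ θ, χ.rotate θ ∈ W} := by
    have h := hWo.preimage (continuous_rotate (F := fun p : CircleDiff × UnitAddCircle => p.1)
      continuous_fst continuous_snd)
    have h2 := isClosedMap_fst_of_compactSpace _ h.isClosed_compl
    rw [← isClosed_compl_iff]
    convert h2 using 1
    ext χ
    simp
  refine ⟨_, ho.mem_nhds fun θ => hW ⟨θ, rfl⟩, ?_⟩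
  rw [pinned, Measure.map_apply (continuous_pin t₀).measurable ho.measurableSet]
  refine (measure_mono fun χ hχ => ?_).trans_lt hWf
  have : (pin t₀ χ).rotate (χ t₀) = χ := ext_apply fun t => by simp [pin]
  exact this ▸ hχ (χ t₀)

theorem MeasureTheory.Measure.le_of_forall_isOpen {X : Type*} [TopologicalSpace X]
    [MeasurableSpace X] {M P : Measure X} [P.OuterRegular]
    (h : ∀ U, IsOpen U → M U ≤ P U) : M ≤ P := by
  refine Measure.le_intro fun A _ _ => ?_
  rw [A.measure_eq_iInf_isOpen P]
  exact le_iInf₂ fun U hU => le_iInf fun ho => (measure_mono hU).trans (h U ho)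

theorem exists_norm_lt_of_ae {p : UnitAddCircle → Prop} (h : ∀ᵐ θ, p θ) {ε : ℝ} (hε : 0 < ε) :
    ∃ θ, ‖θ‖ < ε ∧ p θ := by
  have hpos : volume (Metric.ball (0 : UnitAddCircle) ε) ≠ 0 :=
    (Metric.measure_ball_pos volume 0 hε).ne'
  obtain ⟨θ, hθ, hp⟩ := Measure.exists_mem_of_measure_ne_zero_of_ae hpos (ae_restrict_of_ae h)
  exact ⟨θ, by simpa using hθ, hp⟩

/-- The disintegrated identity may fail at `θ = 0` itself, so `0` is approached through good angles,
one for each approximating diffeomorphism. -/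
theorem exists_tendsto_zero_of_ae {p : ℕ → UnitAddCircle → Prop} (h : ∀ n, ∀ᵐ θ, p n θ) :
    ∃ θ : ℕ → UnitAddCircle, Tendsto θ atTop (𝓝 0) ∧ ∀ n, p n (θ n) := by
  choose θ hθ hp using fun n : ℕ =>
    exists_norm_lt_of_ae (h n) (Nat.one_div_pos_of_nat (α := ℝ) (n := n))
  exact ⟨θ, squeeze_zero_norm (fun n => (hθ n).le) tendsto_one_div_add_atTop_nhds_zero_nat, hp⟩

theorem tendsto_recenter {f : CircleDiff} (hf : f 0 = 0) {ψ : ℕ → CircleDiff}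
    (hψ : Tendsto ψ atTop (𝓝 f)) {θ : ℕ → UnitAddCircle} (hθ : Tendsto θ atTop (𝓝 0)) :
    Tendsto (fun n => (ψ n).recenter (θ n)) atTop (𝓝 f) := by
  have h := (continuous_recenter (F := fun p : CircleDiff × UnitAddCircle => p.1)
    continuous_fst continuous_snd).tendsto (f, 0)
  simp only [recenter_zero hf] at h
  exact h.comp (hψ.prodMk_nhds hθ)

theorem tendsto_comp {F G : ℕ → CircleDiff} {f g : CircleDiff} (hF : Tendsto F atTop (𝓝 f))
    (hG : Tendsto G atTop (𝓝 g)) : Tendsto (fun n => (F n).comp (G n)) atTop (𝓝 (f.comp g)) :=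
  ((continuous_comp (F := fun p : CircleDiff × CircleDiff => p.1)
    continuous_fst continuous_snd).tendsto (f, g)).comp (hF.prodMk_nhds hG)

theorem tendsto_rotate {F : ℕ → CircleDiff} {f : CircleDiff} (hF : Tendsto F atTop (𝓝 f))
    {θ : ℕ → UnitAddCircle} (hθ : Tendsto θ atTop (𝓝 0)) :
    Tendsto (fun n => (F n).rotate (θ n)) atTop (𝓝 f) := by
  have h := (continuous_rotate (F := fun p : CircleDiff × UnitAddCircle => p.1)
    continuous_fst continuous_snd).tendsto (f, 0)
  have h0 : f.rotate 0 = f := ext_apply fun t => by simp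
  simp only [h0] at h
  exact h.comp (hF.prodMk_nhds hθ)

theorem tendsto_derivative_apply {F : ℕ → CircleDiff} {f : CircleDiff}
    (hF : Tendsto F atTop (𝓝 f)) {θ : ℕ → UnitAddCircle} {t : UnitAddCircle}
    (hθ : Tendsto θ atTop (𝓝 t)) :
    Tendsto (fun n => (F n).derivative (θ n)) atTop (𝓝 (f.derivative t)) :=
  ((continuous_eval (F := C(UnitAddCircle, ℝ))).tendsto (f.derivative, t)).comp
    (((continuous_derivative.tendsto f).comp hF).prodMk_nhds hθ)

/-- Lower semicontinuity of the indicator of an open set, with a convergent weight. -/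
theorem mul_indicator_le_liminf {X : Type*} [TopologicalSpace X] {U : Set X} (hU : IsOpen U)
    {x : ℕ → X} {y : X} (hx : Tendsto x atTop (𝓝 y)) {c : ℕ → ℝ≥0∞} {d : ℝ≥0∞}
    (hc : Tendsto c atTop (𝓝 d)) :
    d * U.indicator 1 y ≤ liminf (fun n => c n * U.indicator 1 (x n)) atTop := by
  by_cases hy : y ∈ U
  · have h : Tendsto (fun n => c n * U.indicator 1 (x n)) atTop (𝓝 d) := by
      refine hc.congr' ((hx.eventually (hU.mem_nhds hy)).mono fun n hn => ?_)
      have hn : x n ∈ U := hn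
      simp [hn]
    rw [h.liminf_eq]
    simp [hy]
  · simp [hy]

namespace LeftQuasiInvariant

variable {σ : ℝ} {ν : Measure CircleDiff} {t₀ : UnitAddCircle} {f : CircleDiff}
  {ψ : ℕ → CircleDiff} {s : ℕ → C(UnitAddCircle, ℝ)} {Λ : CircleDiff → ℝ}

theorem tendsto_ofReal_exp {u : ℕ → ℝ} {l : ℝ} (h : Tendsto u atTop (𝓝 l)) :
    Tendsto (fun n => ENNReal.ofReal (Real.exp (u n))) atTop (𝓝 (ENNReal.ofReal (Real.exp l))) :=
  (ENNReal.continuous_ofReal.tendsto _).comp ((Real.continuous_exp.tendsto _).comp h)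

/-- Fatou's lemma in the recentred identities at `θₙ → 0`, tested on `1_U`. Openness of `U` makes
the integrand lower semicontinuous along the sequence, so no domination is needed. -/
theorem lintegral_indicator_comp_le [SFinite ν] (hν : LeftQuasiInvariant σ ν)
    (hψ3 : ∀ n, (ψ n).IsC3)
    (hs : ∀ n, ∀ x : ℝ, schwarzian (ψ n).lift x = s n (x : UnitAddCircle))
    (hf : f 0 = 0) (hψ : Tendsto ψ atTop (𝓝 f))
    (hlim : ∀ (F : ℕ → CircleDiff) (φ : CircleDiff), Tendsto F atTop (𝓝 φ) → φ t₀ = 0 →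
      Tendsto (fun n => pairing (s n) (F n)) atTop (𝓝 (Λ φ)))
    {U : Set CircleDiff} (hU : IsOpen U) :
    ∫⁻ φ, ENNReal.ofReal (Real.exp (Λ φ / σ ^ 2)) * U.indicator 1 (f.comp φ) ∂(pinned t₀ ν)
      ≤ ENNReal.ofReal (f.derivative 0) * pinned t₀ ν U := by
  have hK : Measurable fun p : UnitAddCircle × CircleDiff => U.indicator (1 : CircleDiff → ℝ≥0∞) p.2 :=
    (measurable_one.indicator hU.measurableSet).comp measurable_snd
  obtain ⟨θ, hθ, hθeq⟩ := exists_tendsto_zero_of_ae fun n =>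
    hν.ae_lintegral_recenter t₀ (hψ3 n) (hs n) hK
  simp only [lintegral_indicator_one hU.measurableSet] at hθeq
  have hR : Tendsto (fun n => ENNReal.ofReal ((ψ n).derivative (θ n)) * pinned t₀ ν U) atTop
      (𝓝 (ENNReal.ofReal (f.derivative 0) * pinned t₀ ν U)) :=
    ENNReal.Tendsto.mul_const
      ((ENNReal.continuous_ofReal.tendsto _).comp (tendsto_derivative_apply hψ hθ))
      -- The pinned measure of `U` may be infinite, so the limit of the product needs `f'(0) ≠ 0`.
      (Or.inl (by simpa using f.derivative_pos 0))
  rw [← hR.liminf_eq]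
  simp only [hθeq]
  refine (lintegral_mono_ae ?_).trans (lintegral_liminf_le fun n => ?_)
  · refine (ae_pinned_apply_eq_zero t₀ ν).mono fun φ hφ => ?_
    exact mul_indicator_le_liminf hU
      (tendsto_comp (tendsto_recenter hf hψ hθ) tendsto_const_nhds)
      (tendsto_ofReal_exp ((hlim _ φ (tendsto_rotate tendsto_const_nhds hθ) hφ).div_const _))
  · exact (measurable_ofReal_exp ((continuous_pairing continuous_const
      (continuous_rotate continuous_id continuous_const)).div_const _)).mul
      ((measurable_one.indicator hU.measurableSet).comp
        (continuous_comp continuous_const continuous_id).measurable)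

/-- The companion bound for `f⁻¹`. Fatou's lemma only bounds limits from below, so the reverse
inequality for `f` comes from the inverse maps with reciprocal weights. -/
theorem lintegral_indicator_inv_comp_le [SFinite ν] (hν : LeftQuasiInvariant σ ν)
    (hψ3 : ∀ n, (ψ n).IsC3)
    (hs : ∀ n, ∀ x : ℝ, schwarzian (ψ n).lift x = s n (x : UnitAddCircle))
    (hf : f 0 = 0) (hψ : Tendsto ψ atTop (𝓝 f))
    (hlim : ∀ (F : ℕ → CircleDiff) (φ : CircleDiff), Tendsto F atTop (𝓝 φ) → φ t₀ = 0 →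
      Tendsto (fun n => pairing (s n) (F n)) atTop (𝓝 (Λ φ)))
    {U : Set CircleDiff} (hU : IsOpen U) :
    ∫⁻ φ, ENNReal.ofReal (f.derivative 0) * ENNReal.ofReal (Real.exp (-(Λ (f.inv.comp φ) / σ ^ 2)))
        * U.indicator 1 (f.inv.comp φ) ∂(pinned t₀ ν)
      ≤ pinned t₀ ν U := by
  let g (n : ℕ) (p : UnitAddCircle × CircleDiff) : CircleDiff :=
    ((ψ n).recenter p.1).inv.comp p.2
  have hg (n : ℕ) : Continuous (g n) := continuous_comp
    (CircleDiff.continuous_inv.comp (continuous_recenter continuous_const continuous_fst)) continuous_snd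
  -- Composed with the recentred `ψₙ`, this weight cancels the density exactly, so the right side of
  -- the identity becomes the measure of `U` for every `n`.
  let K (n : ℕ) (p : UnitAddCircle × CircleDiff) : ℝ≥0∞ :=
    ENNReal.ofReal (Real.exp (-(pairing (s n) ((g n p).rotate p.1) / σ ^ 2)))
      * U.indicator 1 (g n p)
  have hK (n : ℕ) : Measurable (K n) :=
    (measurable_ofReal_exp ((continuous_pairing continuous_const
      (continuous_rotate (hg n) continuous_fst)).div_const _).neg).mul
      ((measurable_one.indicator hU.measurableSet).comp (hg n).measurable)
  obtain ⟨θ, hθ, hθeq⟩ := exists_tendsto_zero_of_ae fun n =>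
    hν.ae_lintegral_recenter t₀ (hψ3 n) (hs n) (hK n)
  have hKθ (n : ℕ) : Measurable fun φ => K n (θ n, φ) := (hK n).comp measurable_prodMk_left
  have heq (n : ℕ) : ∫⁻ φ, ENNReal.ofReal ((ψ n).derivative (θ n)) * K n (θ n, φ) ∂(pinned t₀ ν)
      = pinned t₀ ν U := by
    rw [lintegral_const_mul _ (hKθ n), hθeq n, ← lintegral_indicator_one hU.measurableSet]
    refine lintegral_congr fun φ => ?_
    simp only [K, g, inv_comp_comp, ← mul_assoc, ← ENNReal.ofReal_mul (Real.exp_pos _).le,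
      ← Real.exp_add, add_neg_cancel, Real.exp_zero, ENNReal.ofReal_one, one_mul]
  have hconst : pinned t₀ ν U = liminf (fun n =>
      ∫⁻ φ, ENNReal.ofReal ((ψ n).derivative (θ n)) * K n (θ n, φ) ∂(pinned t₀ ν)) atTop := by
    simp only [heq, liminf_const]
  rw [hconst]
  refine (lintegral_mono_ae ?_).trans (lintegral_liminf_le fun n => (hKθ n).const_mul _)
  refine (ae_pinned_apply_eq_zero t₀ ν).mono fun φ hφ => ?_
  have hinv0 : f.inv.comp φ t₀ = 0 := by
    have h := inv_apply_apply f 0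
    rwa [hf, ← hφ, ← CircleDiff.comp_apply, hφ] at h
  have hgt : Tendsto (fun n => g n (θ n, φ)) atTop (𝓝 (f.inv.comp φ)) :=
    tendsto_comp ((CircleDiff.continuous_inv.tendsto f).comp (tendsto_recenter hf hψ hθ)) tendsto_const_nhds
  have hexp := tendsto_ofReal_exp
    ((hlim _ _ (tendsto_rotate hgt hθ) hinv0).div_const (σ ^ 2)).neg
  have hder : Tendsto (fun n => ENNReal.ofReal ((ψ n).derivative (θ n))) atTop
      (𝓝 (ENNReal.ofReal (f.derivative 0))) :=
    (ENNReal.continuous_ofReal.tendsto _).comp (tendsto_derivative_apply hψ hθ)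
  have hprod := ENNReal.Tendsto.mul hder (Or.inr ENNReal.ofReal_ne_top) hexp
    (Or.inr ENNReal.ofReal_ne_top)
  simpa only [K, mul_assoc] using mul_indicator_le_liminf hU hgt hprod

/-- Quasi-invariance of the pinned measure passes to `C¹`-limits `f` of `C³`-diffeomorphisms
whose logarithmic densities converge. -/
theorem lintegral_comp_of_tendsto [SFinite ν] [IsLocallyFiniteMeasure (pinned t₀ ν)]
    (hν : LeftQuasiInvariant σ ν)
    (hψ3 : ∀ n, (ψ n).IsC3)
    (hs : ∀ n, ∀ x : ℝ, schwarzian (ψ n).lift x = s n (x : UnitAddCircle))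
    (hf : f 0 = 0) (hψ : Tendsto ψ atTop (𝓝 f)) (hΛ : Continuous Λ)
    (hlim : ∀ (F : ℕ → CircleDiff) (φ : CircleDiff), Tendsto F atTop (𝓝 φ) → φ t₀ = 0 →
      Tendsto (fun n => pairing (s n) (F n)) atTop (𝓝 (Λ φ)))
    {K : CircleDiff → ℝ≥0∞} (hK : Measurable K) :
    ∫⁻ φ, ENNReal.ofReal (Real.exp (Λ φ / σ ^ 2)) * K (f.comp φ) ∂(pinned t₀ ν)
      = ENNReal.ofReal (f.derivative 0) * ∫⁻ φ, K φ ∂(pinned t₀ ν) := by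
  set P := pinned t₀ ν
  set c := ENNReal.ofReal (f.derivative 0)
  have hc : Continuous fun φ => f.comp φ := continuous_comp continuous_const continuous_id
  have hci : Continuous fun φ => f.inv.comp φ := continuous_comp continuous_const continuous_id
  have hD : Measurable fun φ => ENNReal.ofReal (Real.exp (Λ φ / σ ^ 2)) :=
    measurable_ofReal_exp (hΛ.div_const _)
  have hD' : Measurable fun φ => c * ENNReal.ofReal (Real.exp (-(Λ (f.inv.comp φ) / σ ^ 2))) :=
    (measurable_ofReal_exp ((hΛ.comp hci).div_const _).neg).const_mul _
  have key {g : CircleDiff → CircleDiff} (hg : Continuous g) {D : CircleDiff → ℝ≥0∞}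
      (hDm : Measurable D) {H : CircleDiff → ℝ≥0∞} (hH : Measurable H) :
      ∫⁻ φ, H φ ∂((P.withDensity D).map g) = ∫⁻ φ, D φ * H (g φ) ∂P := by
    have hHg : Measurable fun φ => H (g φ) := hH.comp hg.measurable
    rw [lintegral_map hH hg.measurable, lintegral_withDensity_eq_lintegral_mul _ hDm hHg]
    rfl
  have hle1 : (P.withDensity fun φ => ENNReal.ofReal (Real.exp (Λ φ / σ ^ 2))).map
      (fun φ => f.comp φ) ≤ c • P := by
    have : (c • P).OuterRegular := Measure.OuterRegular.smul P ENNReal.ofReal_ne_top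
    refine Measure.le_of_forall_isOpen fun U hU => ?_
    rw [← lintegral_indicator_one hU.measurableSet,
      key hc hD (measurable_one.indicator hU.measurableSet)]
    exact hν.lintegral_indicator_comp_le hψ3 hs hf hψ hlim hU
  have hle2 : (P.withDensity fun φ =>
      c * ENNReal.ofReal (Real.exp (-(Λ (f.inv.comp φ) / σ ^ 2)))).map
      (fun φ => f.inv.comp φ) ≤ P := by
    refine Measure.le_of_forall_isOpen fun U hU => ?_
    rw [← lintegral_indicator_one hU.measurableSet,
      key hci hD' (measurable_one.indicator hU.measurableSet)]
    exact hν.lintegral_indicator_inv_comp_le hψ3 hs hf hψ hlim hU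
  refine le_antisymm ?_ ?_
  · rw [← key hc hD hK]
    refine (lintegral_mono' hle1 le_rfl).trans_eq ?_
    rw [lintegral_smul_measure, smul_eq_mul]
  -- The inequality for `f⁻¹` is applied to the weighted function itself: the exponentials cancel
  -- and only `f'(0) K` remains.
  · have hH : Measurable fun φ => ENNReal.ofReal (Real.exp (Λ φ / σ ^ 2)) * K (f.comp φ) :=
      hD.mul (hK.comp hc.measurable)
    refine Eq.trans_le ?_ (lintegral_mono' hle2 le_rfl)
    rw [key hci hD' hH, ← lintegral_const_mul _ hK]
    refine lintegral_congr fun φ => ?_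
    rw [comp_inv_comp, mul_assoc, ← mul_assoc (ENNReal.ofReal (Real.exp _)),
      ← ENNReal.ofReal_mul (Real.exp_pos _).le, ← Real.exp_add, neg_add_cancel, Real.exp_zero,
      ENNReal.ofReal_one, one_mul]

end LeftQuasiInvariant

/-! ### Diffeomorphisms with derivative `c / u²` and their Schwarzians. -/

/-- If `g' = c / u²` then `𝒮_g = -2 u'' / u`. -/
theorem schwarzian_of_deriv_eq {g u v : ℝ → ℝ} {c p x : ℝ} (hc : c ≠ 0) (hux : u x ≠ 0)
    (hg : ∀ᶠ y in 𝓝 x, HasDerivAt g (c * (u y ^ 2)⁻¹) y) (hu : ∀ᶠ y in 𝓝 x, HasDerivAt u (v y) y)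
    (hv : HasDerivAt v p x) : schwarzian g x = -2 * p / u x := by
  have hne : ∀ᶠ y in 𝓝 x, u y ≠ 0 :=
    hu.self_of_nhds.continuousAt.eventually_ne hux
  have h1 : deriv g =ᶠ[𝓝 x] fun y => c * (u y ^ 2)⁻¹ := hg.mono fun y hy => hy.deriv
  have hd2 : ∀ᶠ y in 𝓝 x, HasDerivAt (fun y => c * (u y ^ 2)⁻¹) (-2 * c * v y * (u y ^ 3)⁻¹) y := by
    filter_upwards [hu, hne] with y hy hy0
    have := ((hy.pow 2).inv (pow_ne_zero 2 hy0)).const_mul c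
    refine this.congr_deriv ?_
    push_cast
    simp only [Pi.pow_apply]
    field_simp
  have h2 : deriv (deriv g) =ᶠ[𝓝 x] fun y => -2 * c * v y * (u y ^ 3)⁻¹ := by
    filter_upwards [h1.eventuallyEq_nhds, hd2] with y hy hy2
    rw [hy.deriv_eq, hy2.deriv]
  have h3 : HasDerivAt (fun y => -2 * c * v y * (u y ^ 3)⁻¹)
      (-2 * c * p * (u x ^ 3)⁻¹ + 6 * c * v x ^ 2 * (u x ^ 4)⁻¹) x := by
    have := (hv.const_mul (-2 * c)).mul ((hu.self_of_nhds.pow 3).inv (pow_ne_zero 3 hux))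
    refine this.congr_deriv ?_
    push_cast
    simp only [Pi.pow_apply, Pi.inv_apply]
    field_simp
    ring
  have e2 : iteratedDeriv 2 g = deriv (deriv g) := by
    rw [iteratedDeriv_succ, iteratedDeriv_one]
  have e3 : iteratedDeriv 3 g = deriv (deriv (deriv g)) := by rw [iteratedDeriv_succ, e2]
  rw [schwarzian, e3, e2, h2.deriv_eq, h3.deriv, h2.self_of_nhds, h1.self_of_nhds]
  field_simp
  ring

/-- The space of positive continuous functions on the circle. -/
abbrev PosFun : Type := {u : C(UnitAddCircle, ℝ) // ∀ t, 0 < u t}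

namespace PosFun

/-- The reciprocal of a positive function. -/
def recip (u : PosFun) : C(UnitAddCircle, ℝ) :=
  ⟨fun t => (u.1 t)⁻¹, u.1.continuous.inv₀ fun t => (u.2 t).ne'⟩

theorem recip_apply (u : PosFun) (t : UnitAddCircle) : u.recip t = (u.1 t)⁻¹ := rfl

theorem recip_pos (u : PosFun) (t : UnitAddCircle) : 0 < u.recip t := inv_pos.mpr (u.2 t)

theorem continuous_recip : Continuous recip := by
  refine ContinuousMap.continuous_of_continuous_uncurry _ ?_
  change Continuous fun p : PosFun × UnitAddCircle => (p.1.1 p.2)⁻¹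
  exact ((continuous_eval (F := C(UnitAddCircle, ℝ))).comp
    ((continuous_subtype_val.comp continuous_fst).prodMk continuous_snd)).inv₀
    fun p => (p.1.2 p.2).ne'

/-- The total mass of `u⁻²`. -/
def mass (u : PosFun) : ℝ := ∫ x in (0 : ℝ)..1, u.recip (x : UnitAddCircle) ^ 2

theorem mass_pos (u : PosFun) : 0 < u.mass :=
  intervalIntegral.intervalIntegral_pos_of_pos
    (((u.recip.continuous.comp continuous_coe_circle).pow 2).intervalIntegrable _ _)
    (fun _ => pow_pos (u.recip_pos _) 2) one_pos

theorem continuous_mass : Continuous mass := by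
  refine intervalIntegral.continuous_parametric_intervalIntegral_of_continuous'
    (f := fun (u : PosFun) (x : ℝ) => u.recip (x : UnitAddCircle) ^ 2) ?_ _ _
  exact ((continuous_eval (F := C(UnitAddCircle, ℝ))).comp
    ((continuous_recip.comp continuous_fst).prodMk
      (continuous_coe_circle.comp continuous_snd))).pow 2

/-- The probability density proportional to `u⁻²`. -/
def density (u : PosFun) : PosDensity :=
  ⟨u.mass⁻¹ • u.recip ^ 2, fun t => mul_pos (inv_pos.mpr u.mass_pos) (pow_pos (u.recip_pos t) 2), by
    simp only [ContinuousMap.smul_apply, ContinuousMap.pow_apply, smul_eq_mul,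
      intervalIntegral.integral_const_mul]
    exact inv_mul_cancel₀ u.mass_pos.ne'⟩

theorem density_apply (u : PosFun) (t : UnitAddCircle) :
    u.density.1 t = u.mass⁻¹ * (u.1 t ^ 2)⁻¹ := by
  simp [density, recip_apply]

theorem continuous_density : Continuous density :=
  (continuous_mass.inv₀ fun u => u.mass_pos.ne').smul (continuous_recip.pow 2) |>.subtype_mk _

/-- The diffeomorphism fixing `0` with derivative proportional to `u⁻²`. -/
def diffeo (u : PosFun) : CircleDiff := ofDensity u.density

theorem continuous_diffeo : Continuous diffeo := continuous_ofDensity.comp continuous_density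

theorem diffeo_zero (u : PosFun) : u.diffeo 0 = 0 := ofDensity_zero _

theorem derivative_diffeo (u : PosFun) (t : UnitAddCircle) :
    u.diffeo.derivative t = u.mass⁻¹ * (u.1 t ^ 2)⁻¹ := by
  rw [diffeo, derivative_ofDensity, density_apply]

theorem hasDerivAt_lift_diffeo (u : PosFun) (x : ℝ) :
    HasDerivAt u.diffeo.lift (u.mass⁻¹ * (u.1 (x : UnitAddCircle) ^ 2)⁻¹) x := by
  rw [← derivative_diffeo]
  exact u.diffeo.hasDerivAt_lift x

theorem isC3_diffeo (u : PosFun) {v p : C(UnitAddCircle, ℝ)}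
    (hu : ∀ x : ℝ, HasDerivAt (fun y : ℝ => u.1 (y : UnitAddCircle)) (v (x : UnitAddCircle)) x)
    (hv : ∀ x : ℝ, HasDerivAt (fun y : ℝ => v (y : UnitAddCircle)) (p (x : UnitAddCircle)) x) :
    u.diffeo.IsC3 := by
  have hv1 : ContDiff ℝ 1 fun y : ℝ => v (y : UnitAddCircle) := by
    rw [contDiff_one_iff_deriv, funext fun x => (hv x).deriv]
    exact ⟨fun x => (hv x).differentiableAt, p.continuous.comp continuous_coe_circle⟩
  have hu2 : ContDiff ℝ 2 fun y : ℝ => u.1 (y : UnitAddCircle) := by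
    rw [show (2 : WithTop ℕ∞) = 1 + 1 from rfl, contDiff_succ_iff_deriv,
      funext fun x => (hu x).deriv]
    exact ⟨fun x => (hu x).differentiableAt, by simp, hv1⟩
  rw [IsC3, show (3 : WithTop ℕ∞) = 2 + 1 from rfl, contDiff_succ_iff_deriv,
    funext fun x => (u.hasDerivAt_lift_diffeo x).deriv]
  refine ⟨fun x => (u.hasDerivAt_lift_diffeo x).differentiableAt, by simp, ?_⟩
  exact contDiff_const.mul ((hu2.pow 2).inv fun x => pow_ne_zero 2 (u.2 _).ne')

theorem schwarzian_diffeo (u : PosFun) {v p : C(UnitAddCircle, ℝ)}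
    (hu : ∀ x : ℝ, HasDerivAt (fun y : ℝ => u.1 (y : UnitAddCircle)) (v (x : UnitAddCircle)) x)
    (hv : ∀ x : ℝ, HasDerivAt (fun y : ℝ => v (y : UnitAddCircle)) (p (x : UnitAddCircle)) x)
    (x : ℝ) :
    schwarzian u.diffeo.lift x = ((-2 : ℝ) • (p * u.recip)) (x : UnitAddCircle) := by
  rw [schwarzian_of_deriv_eq (inv_ne_zero u.mass_pos.ne') (u.2 _).ne'
    (Eventually.of_forall u.hasDerivAt_lift_diffeo) (Eventually.of_forall hu) (hv x)]
  simp [recip_apply]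
  ring

end PosFun

/-! ### Periodic primitives. -/

section Primitive

theorem continuous_comp_coe (p : C(UnitAddCircle, ℝ)) :
    Continuous fun x : ℝ => p (x : UnitAddCircle) := p.continuous.comp continuous_coe_circle

/-- The primitive vanishing at `0` of a function of mean zero on the circle. -/
def circlePrimitive (p : C(UnitAddCircle, ℝ))
    (hp : ∫ x in (0 : ℝ)..1, p (x : UnitAddCircle) = 0) : C(UnitAddCircle, ℝ) where
  toFun := Function.Periodic.lift (c := (1 : ℝ))
    (f := fun y : ℝ => ∫ x in (0 : ℝ)..y, p (x : UnitAddCircle)) fun y => by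
      beta_reduce
      rw [integral_coe_add_one, hp, add_zero]
  continuous_toFun := by
    apply continuous_coinduced_dom.mpr
    exact continuous_iff_continuousAt.mpr fun x => (hasDerivAt_integral_coe p x).continuousAt

theorem circlePrimitive_neg {p : C(UnitAddCircle, ℝ)}
    (hp : ∫ x in (0 : ℝ)..1, p (x : UnitAddCircle) = 0) (heven : ∀ t, p (-t) = p t)
    (t : UnitAddCircle) : circlePrimitive p hp (-t) = -circlePrimitive p hp t := by
  obtain ⟨y, rfl⟩ := QuotientAddGroup.mk_surjective t
  have h : ∫ x in (0 : ℝ)..(-y), p (x : UnitAddCircle)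
      = -∫ x in (0 : ℝ)..y, p (x : UnitAddCircle) := by
    have := intervalIntegral.integral_comp_neg (a := 0) (b := y)
      fun x : ℝ => p (x : UnitAddCircle)
    simp only [AddCircle.coe_neg, heven, neg_zero] at this
    rw [this, intervalIntegral.integral_symm]
  exact h

theorem integral_eq_zero_of_odd {v : C(UnitAddCircle, ℝ)} (hodd : ∀ t, v (-t) = -v t) :
    ∫ x in (0 : ℝ)..1, v (x : UnitAddCircle) = 0 := by
  have h := intervalIntegral.integral_comp_sub_left (a := 0) (b := 1)
      (fun x : ℝ => v (x : UnitAddCircle)) 1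
  have h1 (x : ℝ) : v ((1 - x : ℝ) : UnitAddCircle) = -v (x : UnitAddCircle) := by
    rw [← hodd, ← AddCircle.coe_neg, show (1 - x : ℝ) = -x + 1 by ring, AddCircle.coe_add_period]
  simp only [h1, sub_self, sub_zero, intervalIntegral.integral_neg] at h
  linarith

end Primitive

/-! ### Even bumps approximating the Dirac mass at `0`. -/

section Bump

/-- The half-width of the `n`-th bump. -/
def bumpWidth (n : ℕ) : ℝ := 1 / ((n : ℝ) + 1)

theorem bumpWidth_pos (n : ℕ) : 0 < bumpWidth n := Nat.one_div_pos_of_nat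

theorem tendsto_bumpWidth : Tendsto bumpWidth atTop (𝓝 0) :=
  tendsto_one_div_add_atTop_nhds_zero_nat

/-- A tent function at `0` on the circle. -/
def tent (n : ℕ) : C(UnitAddCircle, ℝ) :=
  ⟨fun t => max 0 (bumpWidth n - ‖t‖), continuous_const.max (continuous_const.sub continuous_norm)⟩

theorem integral_tent_pos (n : ℕ) : 0 < ∫ x in (0 : ℝ)..1, tent n (x : UnitAddCircle) := by
  refine intervalIntegral.integral_pos one_pos (continuous_comp_coe _).continuousOn
    (fun x _ => le_max_left _ _) ⟨0, by simp, ?_⟩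
  have h : tent n ((0 : ℝ) : UnitAddCircle) = max 0 (bumpWidth n - ‖((0 : ℝ) : UnitAddCircle)‖) :=
    rfl
  rw [h]
  simpa using bumpWidth_pos n

/-- A continuous approximation of the Dirac mass at `0`. -/
def bump (n : ℕ) : C(UnitAddCircle, ℝ) :=
  (∫ x in (0 : ℝ)..1, tent n (x : UnitAddCircle))⁻¹ • tent n

theorem bump_nonneg (n : ℕ) (t : UnitAddCircle) : 0 ≤ bump n t :=
  mul_nonneg (inv_pos.mpr (integral_tent_pos n)).le (le_max_left _ _)

theorem bump_neg (n : ℕ) (t : UnitAddCircle) : bump n (-t) = bump n t := by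
  have h : tent n (-t) = tent n t := by
    change max 0 (bumpWidth n - ‖-t‖) = max 0 (bumpWidth n - ‖t‖)
    rw [norm_neg]
  simp [bump, h]

theorem integral_bump (n : ℕ) : ∫ x in (0 : ℝ)..1, bump n (x : UnitAddCircle) = 1 := by
  simp only [bump, ContinuousMap.smul_apply, smul_eq_mul, intervalIntegral.integral_const_mul]
  exact inv_mul_cancel₀ (integral_tent_pos n).ne'

theorem bump_eq_zero {n : ℕ} {t : UnitAddCircle} (h : bumpWidth n ≤ ‖t‖) : bump n t = 0 := by
  have : tent n t = 0 := max_eq_left (by linarith)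
  simp [bump, this]

/-- The bumps concentrate at `0`. -/
theorem tendsto_integral_bump_mul {w : ℕ → C(UnitAddCircle, ℝ)} {w₀ : C(UnitAddCircle, ℝ)}
    (hw : Tendsto w atTop (𝓝 w₀)) :
    Tendsto (fun n => ∫ x in (0 : ℝ)..1, bump n (x : UnitAddCircle) * w n (x : UnitAddCircle))
      atTop (𝓝 (w₀ 0)) := by
  rw [Metric.tendsto_nhds]
  intro ε hε
  obtain ⟨δ, hδ, hw0⟩ := Metric.continuous_iff.mp w₀.continuous 0 (ε / 4) (by positivity)
  have h1 := Metric.tendsto_nhds.mp hw (ε / 4) (by positivity)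
  have h2 := (tendsto_order.mp tendsto_bumpWidth).2 δ hδ
  filter_upwards [h1, h2] with n hn1 hn2
  have hb (t : UnitAddCircle) : ‖bump n t * (w n t - w₀ 0)‖ ≤ bump n t * (ε / 2) := by
    rw [norm_mul, Real.norm_of_nonneg (bump_nonneg n t)]
    by_cases ht : bumpWidth n ≤ ‖t‖
    · simp [bump_eq_zero ht]
    · refine mul_le_mul_of_nonneg_left ?_ (bump_nonneg n t)
      have e1 : dist (w n t) (w₀ t) < ε / 4 := (ContinuousMap.dist_apply_le_dist t).trans_lt hn1
      have e2 : dist (w₀ t) (w₀ 0) < ε / 4 := hw0 t (by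
        rw [dist_zero_right]; linarith [not_le.mp ht])
      rw [← dist_eq_norm]
      linarith [dist_triangle (w n t) (w₀ t) (w₀ 0)]
  have hsub : (∫ x in (0 : ℝ)..1, bump n (x : UnitAddCircle) * w n (x : UnitAddCircle)) - w₀ 0
      = ∫ x in (0 : ℝ)..1, bump n (x : UnitAddCircle) * (w n (x : UnitAddCircle) - w₀ 0) := by
    have hc := continuous_comp_coe (bump n)
    have h1 : Continuous fun x : ℝ => bump n (x : UnitAddCircle) * w n (x : UnitAddCircle) :=
      hc.mul (continuous_comp_coe (w n))
    have h2 : Continuous fun x : ℝ => bump n (x : UnitAddCircle) * w₀ 0 :=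
      hc.mul continuous_const
    simp only [mul_sub]
    rw [intervalIntegral.integral_sub (h1.intervalIntegrable _ _)
      (h2.intervalIntegrable _ _), intervalIntegral.integral_mul_const,
      integral_bump, one_mul]
  rw [Real.dist_eq, hsub, ← Real.norm_eq_abs]
  refine (intervalIntegral.norm_integral_le_of_norm_le zero_le_one
    (Eventually.of_forall fun x _ => hb _)
    (((continuous_comp_coe (bump n)).mul continuous_const).intervalIntegrable _ _)).trans_lt ?_
  rw [intervalIntegral.integral_mul_const, integral_bump]
  linarith

/-- After substitution the bump is tested against `Bₙ · (Fₙ' ∘ Fₙ⁻¹)`. This converges uniformly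
because inversion is continuous, and `φ⁻¹(0) = t₀`. -/
theorem tendsto_pairing_mul_bump {B : ℕ → C(UnitAddCircle, ℝ)} {B₀ : C(UnitAddCircle, ℝ)}
    (hB : Tendsto B atTop (𝓝 B₀)) {F : ℕ → CircleDiff} {φ : CircleDiff}
    (hF : Tendsto F atTop (𝓝 φ)) {t₀ : UnitAddCircle} (h0 : φ t₀ = 0) :
    Tendsto (fun n => pairing (B n * bump n) (F n)) atTop (𝓝 (B₀ 0 * φ.derivative t₀)) := by
  have hc : Continuous fun χ : CircleDiff => χ.derivative.comp χ.inv.toContinuousMap :=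
    ContinuousMap.continuous_of_continuous_uncurry _
      (continuous_derivative_apply continuous_fst continuous_inv_apply)
  have hw : Tendsto (fun n => B n * (F n).derivative.comp (F n).inv.toContinuousMap) atTop
      (𝓝 (B₀ * φ.derivative.comp φ.inv.toContinuousMap)) :=
    hB.mul ((hc.tendsto φ).comp hF)
  have h := tendsto_integral_bump_mul hw
  have e : (B₀ * φ.derivative.comp φ.inv.toContinuousMap) 0 = B₀ 0 * φ.derivative t₀ := by
    rw [← inv_apply_apply φ t₀, h0]
    rfl
  rw [e] at h
  refine h.congr fun n => ?_
  rw [pairing_eq_integral]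
  refine intervalIntegral.integral_congr fun x _ => ?_
  have e (t : UnitAddCircle) : ((F n).derivative.comp (F n).inv.toContinuousMap) t
    = (F n).derivative ((F n).inv t) := rfl
  simp only [ContinuousMap.mul_apply, e]
  ring

theorem integral_bump_half (n : ℕ) :
    ∫ x in (0 : ℝ)..(1 / 2), bump n (x : UnitAddCircle) = 1 / 2 := by
  have hi := (continuous_comp_coe (bump n)).intervalIntegrable (μ := volume)
  have h1 := intervalIntegral.integral_add_adjacent_intervals (hi 0 (1 / 2)) (hi (1 / 2) 1)
  have h2 := intervalIntegral.integral_comp_sub_left (a := 0) (b := 1 / 2)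
      (fun x : ℝ => bump n (x : UnitAddCircle)) 1
  have h3 (x : ℝ) : bump n ((1 - x : ℝ) : UnitAddCircle) = bump n (x : UnitAddCircle) := by
    rw [← bump_neg, ← AddCircle.coe_neg, ← AddCircle.coe_add_period 1 (-(1 - x))]
    congr 2
    ring
  rw [integral_bump] at h1
  simp only [h3] at h2
  norm_num at h2
  norm_num at h1 ⊢
  linarith

theorem le_norm_coe {ε x : ℝ} (h1 : ε ≤ x) (h2 : x ≤ 1 - ε) : ε ≤ ‖(x : UnitAddCircle)‖ := by
  rw [UnitAddCircle.norm_eq, le_abs]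
  rcases le_or_gt (round x) 0 with h | h
  · left
    have : ((round x : ℤ) : ℝ) ≤ 0 := by exact_mod_cast h
    linarith
  · right
    have : (1 : ℝ) ≤ ((round x : ℤ) : ℝ) := by exact_mod_cast h
    linarith

theorem tendsto_integral_bump {y : ℝ} (hy : y ∈ Ioo (0 : ℝ) 1) :
    Tendsto (fun n => ∫ x in (0 : ℝ)..y, bump n (x : UnitAddCircle)) atTop (𝓝 (1 / 2)) := by
  refine tendsto_const_nhds.congr' ?_
  have h2 := (tendsto_order.mp tendsto_bumpWidth).2 (min (min y (1 - y)) (1 / 2))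
    (by simp [hy.1, hy.2])
  filter_upwards [h2] with n hn
  obtain ⟨⟨h3, h4⟩, h5⟩ : (bumpWidth n < y ∧ bumpWidth n < 1 - y) ∧ bumpWidth n < 1 / 2 := by
    simpa only [lt_min_iff] using hn
  have hi := (continuous_comp_coe (bump n)).intervalIntegrable (μ := volume)
  rw [← intervalIntegral.integral_add_adjacent_intervals (hi 0 (1 / 2)) (hi (1 / 2) y),
    integral_bump_half]
  have : ∫ x in (1 / 2 : ℝ)..y, bump n (x : UnitAddCircle) = ∫ x in (1 / 2 : ℝ)..y, (0 : ℝ) := by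
    refine intervalIntegral.integral_congr fun x hx => bump_eq_zero (le_norm_coe ?_ ?_)
    · exact (le_min h5.le h3.le).trans hx.1
    · exact hx.2.trans (max_le (by linarith) (by linarith))
  rw [this]
  simp

theorem integral_bump_mem_Icc (n : ℕ) {y : ℝ} (hy : y ∈ Icc (0 : ℝ) 1) :
    ∫ x in (0 : ℝ)..y, bump n (x : UnitAddCircle) ∈ Icc (0 : ℝ) 1 := by
  have hi := (continuous_comp_coe (bump n)).intervalIntegrable (μ := volume)
  refine ⟨intervalIntegral.integral_nonneg hy.1 fun x _ => bump_nonneg n _, ?_⟩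
  have h1 := intervalIntegral.integral_add_adjacent_intervals (hi 0 y) (hi y 1)
  have h2 : 0 ≤ ∫ x in y..1, bump n (x : UnitAddCircle) :=
    intervalIntegral.integral_nonneg hy.2 fun x _ => bump_nonneg n _
  rw [integral_bump] at h1
  linarith

/-- By evenness, half of the bump's mass lies on each side of `0`, so its primitive is eventually
`1/2` at each interior point. Dominated convergence turns this into the `L¹` bound that controls the
smoothed kink uniformly. -/
theorem tendsto_integral_abs_primitive_bump :
    Tendsto (fun n => ∫ y in (0 : ℝ)..1,
      |(∫ x in (0 : ℝ)..y, bump n (x : UnitAddCircle)) - 1 / 2|) atTop (𝓝 0) := by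
  have hcont (n : ℕ) : Continuous fun y : ℝ =>
      |(∫ x in (0 : ℝ)..y, bump n (x : UnitAddCircle)) - 1 / 2| :=
    ((continuous_iff_continuousAt.mpr fun x =>
      (hasDerivAt_integral_coe (bump n) x).continuousAt).sub continuous_const).abs
  have h := intervalIntegral.tendsto_integral_filter_of_dominated_convergence (μ := volume)
    (a := 0) (b := 1) (l := atTop)
    (F := fun (n : ℕ) (y : ℝ) => |(∫ x in (0 : ℝ)..y, bump n (x : UnitAddCircle)) - 1 / 2|)
    (f := fun _ => (0 : ℝ)) (fun _ => 1)
    (Eventually.of_forall fun n => (hcont n).aestronglyMeasurable)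
    (Eventually.of_forall fun n => Eventually.of_forall fun y hy => by
      rw [uIoc_of_le zero_le_one] at hy
      have := integral_bump_mem_Icc n (Ioc_subset_Icc_self hy)
      rw [Real.norm_eq_abs, abs_abs, abs_le]
      constructor <;> linarith [this.1, this.2])
    intervalIntegrable_const ?_
  · simpa using h
  · have h1 : ∀ᵐ y : ℝ, y ≠ 1 := by simp [ae_iff]
    filter_upwards [h1] with y hy1 hy
    rw [uIoc_of_le zero_le_one] at hy
    have := (tendsto_integral_bump ⟨hy.1, lt_of_le_of_ne hy.2 hy1⟩).sub_const (1 / 2)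
    simpa using this.abs

end Bump

/-! ### The kinked cosine and its smoothings. -/

/-- `C x = cos (α x)` and `S x = sin (α x) / α` for `α² = a`, with `C > 0` on `[-1/2, 1/2]`. -/
structure IsTrigPair (a : ℝ) (C S : ℝ → ℝ) : Prop where
  hasDerivAt_cos : ∀ x, HasDerivAt C (-a * S x) x
  hasDerivAt_sin : ∀ x, HasDerivAt S (C x) x
  sin_zero : S 0 = 0
  cos_neg : ∀ x, C (-x) = C x
  sin_neg : ∀ x, S (-x) = -S x
  sq_add_sq : ∀ x, C x ^ 2 + a * S x ^ 2 = 1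
  cos_pos : ∀ x ∈ Icc (-(1 / 2) : ℝ) (1 / 2), 0 < C x

namespace IsTrigPair

variable {a : ℝ} {C S : ℝ → ℝ}

theorem continuous_cos (h : IsTrigPair a C S) : Continuous C :=
  continuous_iff_continuousAt.mpr fun x => (h.hasDerivAt_cos x).continuousAt

theorem continuous_sin (h : IsTrigPair a C S) : Continuous S :=
  continuous_iff_continuousAt.mpr fun x => (h.hasDerivAt_sin x).continuousAt

theorem sin_half_pos (h : IsTrigPair a C S) : 0 < S (1 / 2) := by
  have hm : StrictMonoOn S (Icc (-(1 / 2)) (1 / 2)) := by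
    refine strictMonoOn_of_deriv_pos (convex_Icc _ _) h.continuous_sin.continuousOn fun x hx => ?_
    rw [(h.hasDerivAt_sin x).deriv]
    exact h.cos_pos x (interior_subset hx)
  have := hm (show (0 : ℝ) ∈ Icc (-(1 / 2) : ℝ) (1 / 2) by constructor <;> norm_num)
    (show (1 / 2 : ℝ) ∈ Icc (-(1 / 2) : ℝ) (1 / 2) by constructor <;> norm_num) (by norm_num)
  rwa [h.sin_zero] at this

theorem cos_half_pos (h : IsTrigPair a C S) : 0 < C (1 / 2) :=
  h.cos_pos _ (by constructor <;> norm_num)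

/-- The periodic extension of `C (x - 1/2)`, `x ∈ [0, 1]`, with a kink at `0`. -/
def kink (h : IsTrigPair a C S) : C(UnitAddCircle, ℝ) where
  toFun := AddCircle.liftIco 1 0 fun x => C (x - 1 / 2)
  continuous_toFun := AddCircle.liftIco_zero_continuous
    (by rw [← h.cos_neg]; congr 1; norm_num)
    (h.continuous_cos.comp (continuous_id.sub continuous_const)).continuousOn

theorem kink_coe (h : IsTrigPair a C S) {x : ℝ} (hx : x ∈ Icc (0 : ℝ) 1) :
    h.kink (x : UnitAddCircle) = C (x - 1 / 2) := by
  have h0 {y : ℝ} (hy : y ∈ Ico (0 : ℝ) 1) : h.kink (y : UnitAddCircle) = C (y - 1 / 2) :=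
    AddCircle.liftIco_zero_coe_apply (f := fun x => C (x - 1 / 2)) hy
  rcases hx.2.lt_or_eq with h1 | rfl
  · exact h0 ⟨hx.1, h1⟩
  · have := AddCircle.coe_add_period (1 : ℝ) 0
    rw [zero_add] at this
    rw [this, h0 ⟨le_rfl, one_pos⟩, ← h.cos_neg]
    congr 1
    norm_num

theorem exists_coe_eq (t : UnitAddCircle) : ∃ x ∈ Ico (0 : ℝ) 1, (x : UnitAddCircle) = t := by
  refine ⟨AddCircle.equivIco 1 0 t, ?_, AddCircle.coe_equivIco⟩
  simpa using (AddCircle.equivIco 1 0 t).2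

theorem kink_pos (h : IsTrigPair a C S) (t : UnitAddCircle) : 0 < h.kink t := by
  obtain ⟨x, hx, rfl⟩ := exists_coe_eq t
  rw [h.kink_coe (Ico_subset_Icc_self hx)]
  exact h.cos_pos _ ⟨by linarith [hx.1], by linarith [hx.2]⟩

theorem kink_neg (h : IsTrigPair a C S) (t : UnitAddCircle) : h.kink (-t) = h.kink t := by
  obtain ⟨x, hx, rfl⟩ := exists_coe_eq t
  rw [← AddCircle.coe_neg, ← AddCircle.coe_add_period 1 (-x),
    h.kink_coe ⟨by linarith [hx.2], by linarith [hx.1]⟩, h.kink_coe (Ico_subset_Icc_self hx),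
    ← h.cos_neg]
  congr 1
  ring

theorem kink_zero (h : IsTrigPair a C S) : h.kink 0 = C (1 / 2) := by
  have := h.kink_coe (x := 0) (by simp)
  rw [AddCircle.coe_zero] at this
  rw [this, ← h.cos_neg]
  congr 1
  norm_num

theorem integral_kink (h : IsTrigPair a C S) {y : ℝ} (hy : y ∈ Icc (0 : ℝ) 1) :
    ∫ x in (0 : ℝ)..y, h.kink (x : UnitAddCircle) = S (y - 1 / 2) + S (1 / 2) := by
  have h1 : ∫ x in (0 : ℝ)..y, h.kink (x : UnitAddCircle) = ∫ x in (0 : ℝ)..y, C (x - 1 / 2) := by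
    refine intervalIntegral.integral_congr fun x hx => h.kink_coe ?_
    rw [uIcc_of_le hy.1] at hx
    exact ⟨hx.1, hx.2.trans hy.2⟩
  have hd (x : ℝ) : HasDerivAt (fun x => S (x - 1 / 2)) (C (x - 1 / 2)) x :=
    (h.hasDerivAt_sin (x - 1 / 2)).comp_sub_const x (1 / 2)
  rw [h1, intervalIntegral.integral_eq_sub_of_hasDerivAt (fun x _ => hd x)
    ((h.continuous_cos.comp (continuous_id.sub continuous_const)).intervalIntegrable _ _),
    zero_sub, h.sin_neg, sub_neg_eq_add]

/-- A continuous approximation of the second derivative of `kink`, which has a Dirac mass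
at `0`. -/
def curvature (h : IsTrigPair a C S) (n : ℕ) : C(UnitAddCircle, ℝ) :=
  (-a) • h.kink + (2 * a * S (1 / 2)) • bump n

theorem curvature_neg (h : IsTrigPair a C S) (n : ℕ) (t : UnitAddCircle) :
    h.curvature n (-t) = h.curvature n t := by
  simp [curvature, h.kink_neg, bump_neg]

theorem integral_curvature (h : IsTrigPair a C S) (n : ℕ) {y : ℝ} (hy : y ∈ Icc (0 : ℝ) 1) :
    ∫ x in (0 : ℝ)..y, h.curvature n (x : UnitAddCircle)
      = -a * S (y - 1 / 2)
        + 2 * a * S (1 / 2) * ((∫ x in (0 : ℝ)..y, bump n (x : UnitAddCircle)) - 1 / 2) := by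
  have h1 (c : ℝ) (p : C(UnitAddCircle, ℝ)) :
      IntervalIntegrable (fun x : ℝ => c * p (x : UnitAddCircle)) volume 0 y :=
    (continuous_const.mul (continuous_comp_coe p)).intervalIntegrable _ _
  simp only [curvature, ContinuousMap.add_apply, ContinuousMap.smul_apply, smul_eq_mul]
  rw [intervalIntegral.integral_add (h1 _ _) (h1 _ _),
    intervalIntegral.integral_const_mul, intervalIntegral.integral_const_mul, h.integral_kink hy]
  ring

/-- The bump coefficient `2 a S(1/2)` is the jump of the slope of `kink` at `0`. It balances `-a ∫
kink`, which is what makes the slope periodic. -/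
theorem integral_curvature_one (h : IsTrigPair a C S) (n : ℕ) :
    ∫ x in (0 : ℝ)..1, h.curvature n (x : UnitAddCircle) = 0 := by
  rw [h.integral_curvature n (by simp), integral_bump]
  norm_num
  ring

/-- The slope of the smoothed kink. -/
def slope (h : IsTrigPair a C S) (n : ℕ) : C(UnitAddCircle, ℝ) :=
  circlePrimitive (h.curvature n) (h.integral_curvature_one n)

/-- Evenness of the bump and of `kink` makes the slope odd, so a second periodic primitive exists.
-/
theorem integral_slope_one (h : IsTrigPair a C S) (n : ℕ) :
    ∫ x in (0 : ℝ)..1, h.slope n (x : UnitAddCircle) = 0 :=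
  integral_eq_zero_of_odd (circlePrimitive_neg _ (h.curvature_neg n))

/-- A `C²` approximation of `kink`. -/
def smoothKink (h : IsTrigPair a C S) (n : ℕ) : C(UnitAddCircle, ℝ) :=
  ContinuousMap.const _ (C (1 / 2)) + circlePrimitive (h.slope n) (h.integral_slope_one n)

theorem hasDerivAt_slope (h : IsTrigPair a C S) (n : ℕ) (x : ℝ) :
    HasDerivAt (fun y : ℝ => h.slope n (y : UnitAddCircle))
      (h.curvature n (x : UnitAddCircle)) x :=
  hasDerivAt_integral_coe (h.curvature n) x

theorem hasDerivAt_smoothKink (h : IsTrigPair a C S) (n : ℕ) (x : ℝ) :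
    HasDerivAt (fun y : ℝ => h.smoothKink n (y : UnitAddCircle))
      (h.slope n (x : UnitAddCircle)) x :=
  (hasDerivAt_integral_coe (h.slope n) x).const_add _

/-- Both functions equal `C(1/2)` at `0`, so only the difference of their slopes is integrated. -/
theorem smoothKink_sub_kink (h : IsTrigPair a C S) (n : ℕ) {x : ℝ} (hx : x ∈ Icc (0 : ℝ) 1) :
    h.smoothKink n (x : UnitAddCircle) - h.kink (x : UnitAddCircle)
      = 2 * a * S (1 / 2) * ∫ y in (0 : ℝ)..x,
        ((∫ z in (0 : ℝ)..y, bump n (z : UnitAddCircle)) - 1 / 2) := by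
  have hd (y : ℝ) : HasDerivAt (fun y => C (y - 1 / 2)) (-a * S (y - 1 / 2)) y :=
    (h.hasDerivAt_cos (y - 1 / 2)).comp_sub_const y (1 / 2)
  have hSc : Continuous fun y => -a * S (y - 1 / 2) :=
    continuous_const.mul (h.continuous_sin.comp (continuous_id.sub continuous_const))
  have hBc : Continuous fun y : ℝ => (∫ z in (0 : ℝ)..y, bump n (z : UnitAddCircle)) - 1 / 2 :=
    (continuous_iff_continuousAt.mpr fun x =>
      (hasDerivAt_integral_coe (bump n) x).continuousAt).sub continuous_const
  have hBc' : Continuous fun y : ℝ => 2 * a * S (1 / 2) *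
      ((∫ z in (0 : ℝ)..y, bump n (z : UnitAddCircle)) - 1 / 2) := continuous_const.mul hBc
  have h1 : ∫ y in (0 : ℝ)..x, h.slope n (y : UnitAddCircle)
      = ∫ y in (0 : ℝ)..x, (-a * S (y - 1 / 2)
        + 2 * a * S (1 / 2) * ((∫ z in (0 : ℝ)..y, bump n (z : UnitAddCircle)) - 1 / 2)) := by
    refine intervalIntegral.integral_congr fun y hy => h.integral_curvature n ?_
    rw [uIcc_of_le hx.1] at hy
    exact ⟨hy.1, hy.2.trans hx.2⟩
  have h2 : h.smoothKink n (x : UnitAddCircle)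
      = C (1 / 2) + ∫ y in (0 : ℝ)..x, h.slope n (y : UnitAddCircle) := rfl
  rw [h2, h1, intervalIntegral.integral_add (hSc.intervalIntegrable _ _)
    (hBc'.intervalIntegrable _ _),
    intervalIntegral.integral_eq_sub_of_hasDerivAt (fun y _ => hd y) (hSc.intervalIntegrable _ _),
    intervalIntegral.integral_const_mul, h.kink_coe hx, zero_sub, h.cos_neg]
  ring

theorem tendsto_smoothKink (h : IsTrigPair a C S) :
    Tendsto h.smoothKink atTop (𝓝 h.kink) := by
  rw [tendsto_iff_norm_sub_tendsto_zero]
  have hlim := tendsto_integral_abs_primitive_bump.const_mul |2 * a * S (1 / 2)|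
  rw [mul_zero] at hlim
  refine squeeze_zero (fun n => norm_nonneg _) (fun n => ?_) hlim
  have hBc : Continuous fun y : ℝ => (∫ z in (0 : ℝ)..y, bump n (z : UnitAddCircle)) - 1 / 2 :=
    (continuous_iff_continuousAt.mpr fun x =>
      (hasDerivAt_integral_coe (bump n) x).continuousAt).sub continuous_const
  have hnn : 0 ≤ ∫ y in (0 : ℝ)..1, |(∫ x in (0 : ℝ)..y, bump n (x : UnitAddCircle)) - 1 / 2| :=
    intervalIntegral.integral_nonneg zero_le_one fun _ _ => abs_nonneg _
  rw [ContinuousMap.norm_le _ (mul_nonneg (abs_nonneg _) hnn)]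
  intro t
  obtain ⟨x, hx, rfl⟩ := exists_coe_eq t
  rw [ContinuousMap.sub_apply, h.smoothKink_sub_kink n (Ico_subset_Icc_self hx), norm_mul,
    Real.norm_eq_abs (2 * a * S (1 / 2))]
  refine mul_le_mul_of_nonneg_left ?_ (abs_nonneg _)
  refine (intervalIntegral.norm_integral_le_integral_norm hx.1).trans ?_
  simp only [Real.norm_eq_abs]
  exact intervalIntegral.integral_mono_interval le_rfl hx.1 hx.2.le
    (Eventually.of_forall fun _ => abs_nonneg _) (hBc.abs.intervalIntegrable _ _)

/-- `kink` as a positive function. -/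
def kinkPos (h : IsTrigPair a C S) : PosFun := ⟨h.kink, h.kink_pos⟩

theorem exists_forall_smoothKink_pos (h : IsTrigPair a C S) :
    ∃ N, ∀ n, ∀ t, 0 < h.smoothKink (n + N) t := by
  have ho : IsOpen {u : C(UnitAddCircle, ℝ) | MapsTo u univ (Ioi 0)} :=
    ContinuousMap.isOpen_setOfPred_mapsTo isCompact_univ isOpen_Ioi
  have := h.tendsto_smoothKink.eventually (ho.mem_nhds fun t _ => h.kink_pos t)
  obtain ⟨N, hN⟩ := eventually_atTop.mp this
  exact ⟨N, fun n t => hN (n + N) (Nat.le_add_left _ _) (mem_univ t)⟩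

/-- The circle diffeomorphism with constant Schwarzian `2 a` away from `0`. -/
def diffeo (h : IsTrigPair a C S) : CircleDiff := h.kinkPos.diffeo

/-- `diffeo` is a limit of `C³`-diffeomorphisms whose Schwarzians converge weakly to `2 a` plus a
Dirac mass at `0`. -/
theorem exists_approx (h : IsTrigPair a C S) (t₀ : UnitAddCircle) :
    ∃ (ψ : ℕ → CircleDiff) (s : ℕ → C(UnitAddCircle, ℝ)), (∀ n, (ψ n).IsC3) ∧
      (∀ n, ∀ x : ℝ, schwarzian (ψ n).lift x = s n (x : UnitAddCircle)) ∧
      Tendsto ψ atTop (𝓝 h.diffeo) ∧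
      ∀ (F : ℕ → CircleDiff) (φ : CircleDiff), Tendsto F atTop (𝓝 φ) → φ t₀ = 0 →
        Tendsto (fun n => pairing (s n) (F n)) atTop
          (𝓝 (2 * a * φ.energy - 4 * a * S (1 / 2) / C (1 / 2) * φ.derivative t₀)) := by
  obtain ⟨N, hN⟩ := h.exists_forall_smoothKink_pos
  let u (n : ℕ) : PosFun := ⟨h.smoothKink (n + N), hN n⟩
  have hu : Tendsto u atTop (𝓝 h.kinkPos) :=
    tendsto_subtype_rng.mpr (h.tendsto_smoothKink.comp (tendsto_add_atTop_nat N))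
  have hr : Tendsto (fun n => (u n).recip) atTop (𝓝 h.kinkPos.recip) :=
    (PosFun.continuous_recip.tendsto _).comp hu
  refine ⟨fun n => (u n).diffeo, fun n => (-2 : ℝ) • (h.curvature (n + N) * (u n).recip),
    fun n => (u n).isC3_diffeo (h.hasDerivAt_smoothKink (n + N)) (h.hasDerivAt_slope (n + N)),
    fun n => (u n).schwarzian_diffeo (h.hasDerivAt_smoothKink (n + N))
      (h.hasDerivAt_slope (n + N)),
    (PosFun.continuous_diffeo.tendsto _).comp hu, fun F φ hF h0 => ?_⟩
  -- The regular part tends uniformly to the constant `2a`; the bump part tends to a Dirac mass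
  -- weighted by `1 / kink(0)`.
  have hsplit (n : ℕ) : (-2 : ℝ) • (h.curvature (n + N) * (u n).recip)
      = (2 * a) • (h.kink * (u n).recip)
        + ((-(4 * a * S (1 / 2))) • (u n).recip) * bump (n + N) := by
    ext t
    simp only [curvature, ContinuousMap.add_apply, ContinuousMap.smul_apply,
      ContinuousMap.mul_apply, smul_eq_mul]
    ring
  have hA : Tendsto (fun n => pairing (h.kink * (u n).recip) (F n)) atTop (𝓝 φ.energy) := by
    have h1 : h.kink * h.kinkPos.recip = 1 := by
      ext t
      exact mul_inv_cancel₀ (h.kink_pos t).ne'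
    rw [← pairing_one, ← h1]
    exact ((continuous_pairing (s := fun p : C(UnitAddCircle, ℝ) × CircleDiff => p.1)
      continuous_fst continuous_snd).tendsto (_, φ)).comp ((hr.const_mul h.kink).prodMk_nhds hF)
  have hB : Tendsto (fun n => pairing (((-(4 * a * S (1 / 2))) • (u n).recip) * bump (n + N)) (F n))
      atTop (𝓝 (((-(4 * a * S (1 / 2))) • h.kinkPos.recip) 0 * φ.derivative t₀)) := by
    -- The bump has index `n + N`, so the other sequences are shifted back by the truncated `n - N`
    -- before the limit and forward again after it.
    have h1 := (tendsto_pairing_mul_bump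
      ((hr.const_smul (-(4 * a * S (1 / 2)))).comp (tendsto_sub_atTop_nat N))
      (hF.comp (tendsto_sub_atTop_nat N)) h0).comp (tendsto_add_atTop_nat N)
    refine h1.congr fun n => ?_
    simp only [Function.comp_apply, Nat.add_sub_cancel]
  have e : ((-(4 * a * S (1 / 2))) • h.kinkPos.recip) 0 = -(4 * a * S (1 / 2) / C (1 / 2)) := by
    rw [ContinuousMap.smul_apply, PosFun.recip_apply, kinkPos, h.kink_zero, smul_eq_mul]
    ring
  rw [e] at hB
  simp only [hsplit, pairing_add, pairing_smul]
  convert (hA.const_mul (2 * a)).add hB using 2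
  ring

end IsTrigPair

/-! ### Trigonometric, hyperbolic and affine cases, and the map `f_α`. -/

namespace IsTrigPair

variable {a : ℝ} {C S : ℝ → ℝ}

theorem one_id : IsTrigPair 0 (fun _ => 1) (fun x => x) where
  hasDerivAt_cos x := by simpa using hasDerivAt_const x (1 : ℝ)
  hasDerivAt_sin x := hasDerivAt_id x
  sin_zero := rfl
  cos_neg _ := rfl
  sin_neg _ := rfl
  sq_add_sq _ := by simp
  cos_pos _ _ := one_pos

theorem of_real {r : ℝ} (hr : r ≠ 0) (hπ : r ^ 2 < Real.pi ^ 2) :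
    IsTrigPair (r ^ 2) (fun x => Real.cos (r * x)) (fun x => Real.sin (r * x) / r) where
  hasDerivAt_cos x := by
    refine (((hasDerivAt_id x).const_mul r).cos).congr_deriv ?_
    simp only [id]
    field_simp
  hasDerivAt_sin x := by
    refine ((((hasDerivAt_id x).const_mul r).sin).div_const r).congr_deriv ?_
    simp only [id]
    field_simp
  sin_zero := by simp
  cos_neg x := by simp
  sin_neg x := by simp [neg_div]
  sq_add_sq x := by
    rw [div_pow, mul_div_cancel₀ _ (pow_ne_zero 2 hr)]
    exact Real.cos_sq_add_sin_sq _
  cos_pos x hx := by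
    have h1 : |r| < Real.pi := abs_lt_of_sq_lt_sq hπ Real.pi_pos.le
    have h2 : |x| ≤ 1 / 2 := abs_le.mpr hx
    have h3 : |r * x| < Real.pi / 2 := by
      rw [abs_mul]
      nlinarith [abs_nonneg r, abs_nonneg x]
    exact Real.cos_pos_of_mem_Ioo (abs_lt.mp h3)

theorem of_imaginary {r : ℝ} (hr : r ≠ 0) :
    IsTrigPair (-r ^ 2) (fun x => Real.cosh (r * x)) (fun x => Real.sinh (r * x) / r) where
  hasDerivAt_cos x := by
    refine (((hasDerivAt_id x).const_mul r).cosh).congr_deriv ?_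
    simp only [id]
    field_simp
  hasDerivAt_sin x := by
    refine ((((hasDerivAt_id x).const_mul r).sinh).div_const r).congr_deriv ?_
    simp only [id]
    field_simp
  sin_zero := by simp
  cos_neg x := by simp
  sin_neg x := by simp [neg_div]
  sq_add_sq x := by
    rw [div_pow, neg_mul, mul_div_cancel₀ _ (pow_ne_zero 2 hr), ← sub_eq_add_neg]
    exact Real.cosh_sq_sub_sinh_sq _
  cos_pos x _ := Real.cosh_pos _

/-- A real `α²` forces `α` to be real or purely imaginary. The last clause is needed because
`sin(αx) = α S(x)` says nothing about `S` when `α = 0`. -/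
theorem exists_of_sq_real {α : ℂ} (hα : (α ^ 2).im = 0) (hαπ : (α ^ 2).re < Real.pi ^ 2) :
    ∃ C S : ℝ → ℝ, IsTrigPair (α ^ 2).re C S ∧ (∀ x : ℝ, Complex.cos (α * x) = C x) ∧
      (∀ x : ℝ, Complex.sin (α * x) = α * S x) ∧ (α = 0 → ∀ x, S x = x) := by
  have hprod : α.re = 0 ∨ α.im = 0 := by
    have : α.re * α.im = 0 := by
      simp only [pow_two, Complex.mul_im] at hα
      linarith
    exact mul_eq_zero.mp this
  by_cases h0 : α = 0
  · refine ⟨_, _, by simpa [h0] using one_id, fun x => by simp [h0], fun x => by simp [h0],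
      fun _ x => rfl⟩
  rcases hprod with h | h
  · obtain ⟨r, rfl⟩ : ∃ r : ℝ, α = r * Complex.I := ⟨α.im, by
      apply Complex.ext <;> simp [h]⟩
    have hr : r ≠ 0 := by rintro rfl; simp at h0
    have hre : ((r * Complex.I) ^ 2).re = -r ^ 2 := by
      rw [mul_pow, Complex.I_sq]; norm_cast; simp
    rw [hre]
    refine ⟨_, _, of_imaginary hr, fun x => ?_, fun x => ?_, fun h => absurd h h0⟩
    · rw [show (r : ℂ) * Complex.I * x = ((r * x : ℝ) : ℂ) * Complex.I by push_cast; ring,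
        Complex.cos_mul_I, Complex.ofReal_cosh]
    · rw [show (r : ℂ) * Complex.I * x = ((r * x : ℝ) : ℂ) * Complex.I by push_cast; ring,
        Complex.sin_mul_I, Complex.ofReal_div, Complex.ofReal_sinh]
      have : (r : ℂ) ≠ 0 := by exact_mod_cast hr
      field_simp
  · obtain ⟨r, rfl⟩ : ∃ r : ℝ, α = r := ⟨α.re, by apply Complex.ext <;> simp [h]⟩
    have hr : r ≠ 0 := by rintro rfl; simp at h0
    have hre : ((r : ℂ) ^ 2).re = r ^ 2 := by norm_cast
    rw [hre] at hαπ ⊢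
    refine ⟨_, _, of_real hr hαπ, fun x => ?_, fun x => ?_, fun h => absurd h h0⟩
    · rw [← Complex.ofReal_mul, Complex.ofReal_cos]
    · rw [← Complex.ofReal_mul, Complex.ofReal_div, Complex.ofReal_sin]
      have : (r : ℂ) ≠ 0 := by exact_mod_cast hr
      field_simp

theorem contDiff (h : IsTrigPair a C S) (n : ℕ) : ContDiff ℝ n C ∧ ContDiff ℝ n S := by
  induction n with
  | zero => exact ⟨contDiff_zero.mpr h.continuous_cos, contDiff_zero.mpr h.continuous_sin⟩
  | succ k ih =>
    push_cast
    rw [contDiff_succ_iff_deriv, contDiff_succ_iff_deriv,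
      funext fun x => (h.hasDerivAt_cos x).deriv, funext fun x => (h.hasDerivAt_sin x).deriv]
    exact ⟨⟨fun x => (h.hasDerivAt_cos x).differentiableAt, by simp, contDiff_const.mul ih.2⟩,
      ⟨fun x => (h.hasDerivAt_sin x).differentiableAt, by simp, ih.1⟩⟩

/-- The map `f_α` in terms of `C = cos (α ·)` and `S = sin (α ·) / α`. -/
def tanMap (_ : IsTrigPair a C S) (t : ℝ) : ℝ :=
  1 / 2 * (C (1 / 2) / S (1 / 2) * (S (t - 1 / 2) / C (t - 1 / 2)) + 1)

theorem tanMap_zero (h : IsTrigPair a C S) : h.tanMap 0 = 0 := by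
  have h1 := h.sin_half_pos.ne'
  have h2 := h.cos_half_pos.ne'
  rw [tanMap, zero_sub, h.sin_neg, h.cos_neg]
  field_simp
  ring

theorem tanMap_one (h : IsTrigPair a C S) : h.tanMap 1 = 1 := by
  have h1 := h.sin_half_pos.ne'
  have h2 := h.cos_half_pos.ne'
  rw [tanMap, show (1 : ℝ) - 1 / 2 = 1 / 2 by norm_num]
  field_simp
  ring

theorem hasDerivAt_tanMap (h : IsTrigPair a C S) {t : ℝ} (ht : C (t - 1 / 2) ≠ 0) :
    HasDerivAt h.tanMap (C (1 / 2) / (2 * S (1 / 2)) * (C (t - 1 / 2) ^ 2)⁻¹) t := by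
  have h1 := h.sin_half_pos.ne'
  have hC : HasDerivAt (fun y => C (y - 1 / 2)) (-a * S (t - 1 / 2)) t :=
    (h.hasDerivAt_cos (t - 1 / 2)).comp_sub_const t (1 / 2)
  have hS : HasDerivAt (fun y => S (y - 1 / 2)) (C (t - 1 / 2)) t :=
    (h.hasDerivAt_sin (t - 1 / 2)).comp_sub_const t (1 / 2)
  refine ((((hS.div hC ht).const_mul (C (1 / 2) / S (1 / 2))).add_const 1).const_mul
    (1 / 2)).congr_deriv ?_
  have h2 : C (t - 1 / 2) * C (t - 1 / 2) - S (t - 1 / 2) * (-a * S (t - 1 / 2)) = 1 := by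
    linear_combination h.sq_add_sq (t - 1 / 2)
  rw [h2]
  field_simp

theorem cos_sub_half_pos (h : IsTrigPair a C S) {t : ℝ} (ht : t ∈ Icc (0 : ℝ) 1) :
    0 < C (t - 1 / 2) := h.cos_pos _ ⟨by linarith [ht.1], by linarith [ht.2]⟩

theorem tanMap_isIntervalDiff3 (h : IsTrigPair a C S) : IsIntervalDiff3 h.tanMap where
  contDiffOn := by
    have hsub : ContDiff ℝ 3 fun t : ℝ => t - 1 / 2 := contDiff_id.sub contDiff_const
    have hC : ContDiff ℝ 3 fun t => C (t - 1 / 2) := (h.contDiff 3).1.comp hsub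
    have hS : ContDiff ℝ 3 fun t => S (t - 1 / 2) := (h.contDiff 3).2.comp hsub
    exact contDiffOn_const.mul ((contDiffOn_const.mul (hS.contDiffOn.div hC.contDiffOn
      fun t ht => (h.cos_sub_half_pos ht).ne')).add contDiffOn_const)
  map_zero := h.tanMap_zero
  map_one := h.tanMap_one
  deriv_pos t ht := by
    have hp := h.cos_sub_half_pos ht
    rw [(h.hasDerivAt_tanMap hp.ne').hasDerivWithinAt.derivWithin
      (uniqueDiffOn_Icc zero_lt_one t ht)]
    have := h.cos_half_pos
    have := h.sin_half_pos
    positivity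

theorem schwarzian_tanMap (h : IsTrigPair a C S) {t : ℝ} (ht : t ∈ Icc (0 : ℝ) 1) :
    schwarzian h.tanMap t = 2 * a := by
  have hp := h.cos_sub_half_pos ht
  have hκ : C (1 / 2) / (2 * S (1 / 2)) ≠ 0 :=
    (div_pos h.cos_half_pos (mul_pos two_pos h.sin_half_pos)).ne'
  have hC (y : ℝ) : HasDerivAt (fun y => C (y - 1 / 2)) (-a * S (y - 1 / 2)) y :=
    (h.hasDerivAt_cos (y - 1 / 2)).comp_sub_const y (1 / 2)
  have hS : HasDerivAt (fun y => -a * S (y - 1 / 2)) (-a * C (t - 1 / 2)) t :=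
    ((h.hasDerivAt_sin (t - 1 / 2)).comp_sub_const t (1 / 2)).const_mul (-a)
  rw [schwarzian_of_deriv_eq (u := fun y => C (y - 1 / 2)) hκ hp.ne'
    (((hC t).continuousAt.eventually_ne hp.ne').mono fun y hy => h.hasDerivAt_tanMap hy)
    (Eventually.of_forall hC) hS, div_eq_iff hp.ne']
  ring

theorem integral_recip_sq (h : IsTrigPair a C S) {t : ℝ} (ht : t ∈ Icc (0 : ℝ) 1) :
    C (1 / 2) / (2 * S (1 / 2)) * ∫ x in (0 : ℝ)..t, (h.kink (x : UnitAddCircle) ^ 2)⁻¹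
      = h.tanMap t := by
  have hsub {x : ℝ} (hx : x ∈ uIcc 0 t) : x ∈ Icc (0 : ℝ) 1 := by
    rw [uIcc_of_le ht.1] at hx
    exact ⟨hx.1, hx.2.trans ht.2⟩
  have h1 : ∫ x in (0 : ℝ)..t, C (1 / 2) / (2 * S (1 / 2)) * (h.kink (x : UnitAddCircle) ^ 2)⁻¹
      = h.tanMap t - h.tanMap 0 := by
    refine intervalIntegral.integral_eq_sub_of_hasDerivAt (fun x hx => ?_) ?_
    · rw [h.kink_coe (hsub hx)]
      exact h.hasDerivAt_tanMap (h.cos_sub_half_pos (hsub hx)).ne'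
    · exact (continuous_const.mul (((continuous_comp_coe h.kink).pow 2).inv₀
        fun x => pow_ne_zero 2 (h.kink_pos _).ne')).intervalIntegrable _ _
  rw [← intervalIntegral.integral_const_mul, h1, h.tanMap_zero, sub_zero]

/-- `tanMap` is a primitive of a multiple of `kink⁻²` running from `0` to `1`, so that multiple is
the normalising constant. -/
theorem inv_mass_kinkPos (h : IsTrigPair a C S) :
    h.kinkPos.mass⁻¹ = C (1 / 2) / (2 * S (1 / 2)) := by
  have h1 := h.integral_recip_sq (t := 1) (by simp)
  rw [h.tanMap_one] at h1
  rw [inv_eq_iff_eq_inv, PosFun.mass]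
  simp only [PosFun.recip_apply, inv_pow]
  exact eq_inv_of_mul_eq_one_right h1

theorem diffeo_coe (h : IsTrigPair a C S) {t : ℝ} (ht : t ∈ Icc (0 : ℝ) 1) :
    h.diffeo (t : UnitAddCircle) = (h.tanMap t : UnitAddCircle) := by
  rw [diffeo, PosFun.diffeo, ofDensity_coe]
  simp only [PosFun.density_apply, intervalIntegral.integral_const_mul, h.inv_mass_kinkPos]
  exact congrArg _ (h.integral_recip_sq ht)

theorem derivative_diffeo_zero (h : IsTrigPair a C S) :
    h.diffeo.derivative 0 = 1 / (2 * S (1 / 2) * C (1 / 2)) := by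
  have h1 := h.sin_half_pos.ne'
  have h2 := h.cos_half_pos.ne'
  rw [diffeo, PosFun.derivative_diffeo, h.inv_mass_kinkPos, kinkPos, h.kink_zero]
  field_simp

variable {α : ℂ}

/-- The factors `α` cancel between the two tangents. Division by zero is conventional on both sides,
so the equality holds on the whole line and carries over the two-sided derivatives in `schwarzian`
at the endpoints `0` and `1`. -/
theorem fAlpha_eq_tanMap (h : IsTrigPair a C S) (hC : ∀ x : ℝ, Complex.cos (α * x) = C x)
    (hS : ∀ x : ℝ, Complex.sin (α * x) = α * S x) (h0 : α = 0 → ∀ x, S x = x) :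
    fAlpha α = h.tanMap := by
  funext t
  by_cases hα : α = 0
  · have hC1 (x : ℝ) : C x = 1 := by
      have := hC x
      rw [hα, zero_mul, Complex.cos_zero] at this
      exact_mod_cast this.symm
    rw [fAlpha, if_pos hα, tanMap, h0 hα, h0 hα, hC1, hC1]
    ring
  · have e1 : Complex.tan (α / 2) = α * S (1 / 2) / C (1 / 2) := by
      have : α / 2 = α * ((1 / 2 : ℝ) : ℂ) := by push_cast; ring
      rw [this, Complex.tan, hC, hS]
    have e2 : Complex.tan (α * ((t : ℂ) - 1 / 2)) = α * S (t - 1 / 2) / C (t - 1 / 2) := by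
      have : α * ((t : ℂ) - 1 / 2) = α * ((t - 1 / 2 : ℝ) : ℂ) := by push_cast; ring
      rw [this, Complex.tan, hC, hS]
    rw [fAlpha, if_neg hα, e1, e2]
    have e3 : (1 / 2 : ℂ) * (1 / (α * S (1 / 2) / C (1 / 2)) * (α * S (t - 1 / 2) / C (t - 1 / 2)) + 1)
        = ((h.tanMap t : ℝ) : ℂ) := by
      have : (S (1 / 2) : ℂ) ≠ 0 := by exact_mod_cast h.sin_half_pos.ne'
      rw [tanMap]
      push_cast
      field_simp
    rw [e3, Complex.ofReal_re]

theorem alphaDivSin_eq (h : IsTrigPair a C S) (hC : ∀ x : ℝ, Complex.cos (α * x) = C x)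
    (hS : ∀ x : ℝ, Complex.sin (α * x) = α * S x) (h0 : α = 0 → ∀ x, S x = x) :
    alphaDivSin α = h.diffeo.derivative 0 := by
  rw [h.derivative_diffeo_zero]
  by_cases hα : α = 0
  · have hC1 (x : ℝ) : C x = 1 := by
      have := hC x
      rw [hα, zero_mul, Complex.cos_zero] at this
      exact_mod_cast this.symm
    rw [alphaDivSin, if_pos hα, h0 hα, hC1]
    norm_num
  -- The double angle formula at `α / 2`.
  · have e1 : Complex.sin α = 2 * (α * S (1 / 2)) * C (1 / 2) := by
      rw [← hC, ← hS, ← Complex.sin_two_mul]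
      congr 1
      push_cast
      ring
    have e2 : α / Complex.sin α = ((1 / (2 * S (1 / 2) * C (1 / 2)) : ℝ) : ℂ) := by
      rw [e1]
      push_cast
      field_simp
    rw [alphaDivSin, if_neg hα, e2, Complex.ofReal_re]

theorem defectCoeff_eq (hS : ∀ x : ℝ, Complex.sin (α * x) = α * S x) :
    defectCoeff α = 8 * (α ^ 2).re * S (1 / 2) ^ 2 := by
  have e1 : Complex.sin (α / 2) = α * S (1 / 2) := by
    rw [← hS]
    congr 1
    push_cast
    ring
  have e2 : 8 * (α * (S (1 / 2) : ℂ)) ^ 2 = ((8 * S (1 / 2) ^ 2 : ℝ) : ℂ) * α ^ 2 := by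
    push_cast
    ring
  rw [defectCoeff, e1, e2, Complex.re_ofReal_mul]
  ring

end IsTrigPair

/-! ### The identity for pinned orbital measures. -/

/-- The energy is rotation invariant, so reweighting by it commutes with pinning. -/
theorem lintegral_pinned_orbitalFamily (σ a₀ a : ℝ) (μ : Measure CircleDiff) (t₀ : UnitAddCircle)
    {H : CircleDiff → ℝ≥0∞} (hH : Measurable H) :
    ∫⁻ φ, H φ ∂(pinned t₀ (orbitalFamily σ a₀ μ a))
      = ∫⁻ φ, ENNReal.ofReal (Real.exp (2 * a * φ.energy / σ ^ 2)) * H φ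
          ∂(pinned t₀ (orbitalFamily σ a₀ μ 0)) := by
  have hpin : Measurable (pin t₀) := (continuous_pin t₀).measurable
  have hE (b : ℝ) : Measurable fun φ : CircleDiff =>
      ENNReal.ofReal (Real.exp (2 * (b - a₀) / σ ^ 2 * φ.energy)) :=
    measurable_ofReal_exp (continuous_const.mul continuous_energy)
  have hE' : Measurable fun φ : CircleDiff =>
      ENNReal.ofReal (Real.exp (2 * a * φ.energy / σ ^ 2)) :=
    measurable_ofReal_exp ((continuous_const.mul continuous_energy).div_const _)
  have hH1 : Measurable fun φ => H (pin t₀ φ) := hH.comp hpin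
  have hEH : Measurable fun φ : CircleDiff =>
      ENNReal.ofReal (Real.exp (2 * a * φ.energy / σ ^ 2)) * H φ := hE'.mul hH
  have hH2 : Measurable fun φ =>
      ENNReal.ofReal (Real.exp (2 * a * (pin t₀ φ).energy / σ ^ 2)) * H (pin t₀ φ) :=
    hEH.comp hpin
  rw [pinned, pinned, lintegral_map hH hpin, lintegral_map hEH hpin, orbitalFamily,
    orbitalFamily, lintegral_withDensity_eq_lintegral_mul _ (hE a) hH1,
    lintegral_withDensity_eq_lintegral_mul _ (hE 0) hH2]
  refine lintegral_congr fun φ => ?_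
  simp only [Pi.mul_apply, pin, energy_rotate, ← mul_assoc,
    ← ENNReal.ofReal_mul (Real.exp_pos _).le, ← Real.exp_add]
  congr 3
  ring

namespace IsTrigPair

variable {a : ℝ} {C S : ℝ → ℝ}

theorem diffeo_zero (h : IsTrigPair a C S) : h.diffeo 0 = 0 := h.kinkPos.diffeo_zero

theorem lintegral_diffeo_comp (h : IsTrigPair a C S) {σ a₀ : ℝ} {μ : Measure CircleDiff}
    (hμ : IsOrbitalMeasure σ a₀ μ) (t₀ : UnitAddCircle)
    {G : CircleDiff → ℝ≥0∞} (hG : Measurable G) :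
    ∫⁻ φ, G (h.diffeo.comp φ) ∂(pinned t₀ (orbitalFamily σ a₀ μ a))
      = ENNReal.ofReal (h.diffeo.derivative 0) *
        ∫⁻ φ, G φ * ENNReal.ofReal
          (Real.exp (8 * a * S (1 / 2) ^ 2 / σ ^ 2 * φ.derivative t₀))
          ∂(pinned t₀ (orbitalFamily σ a₀ μ 0)) := by
  have := hμ.locallyFinite
  have : IsLocallyFiniteMeasure (orbitalFamily σ a₀ μ 0) :=
    IsLocallyFiniteMeasure.withDensity_ofReal
      (Real.continuous_exp.comp (continuous_const.mul continuous_energy))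
  have := isLocallyFiniteMeasure_pinned t₀ (orbitalFamily σ a₀ μ 0)
  have hc : Continuous fun φ => h.diffeo.comp φ := continuous_comp continuous_const continuous_id
  have hd : Continuous fun φ : CircleDiff => φ.derivative t₀ :=
    continuous_derivative_apply continuous_id continuous_const
  obtain ⟨ψ, s, hψ3, hs, hψ, hlim⟩ := h.exists_approx t₀
  have hΛ : Continuous fun φ : CircleDiff =>
      2 * a * φ.energy - 4 * a * S (1 / 2) / C (1 / 2) * φ.derivative t₀ :=
    (continuous_const.mul continuous_energy).sub (continuous_const.mul hd)
  have hK : Measurable fun φ : CircleDiff => G φ * ENNReal.ofReal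
      (Real.exp (8 * a * S (1 / 2) ^ 2 / σ ^ 2 * φ.derivative t₀)) :=
    hG.mul (measurable_ofReal_exp (continuous_const.mul hd))
  have hGc : Measurable fun φ => G (h.diffeo.comp φ) := hG.comp hc.measurable
  rw [lintegral_pinned_orbitalFamily σ a₀ a μ t₀ hGc,
    ← hμ.leftQuasiInvariant.lintegral_comp_of_tendsto hψ3 hs h.diffeo_zero hψ hΛ hlim hK]
  refine lintegral_congr_ae ((ae_pinned_apply_eq_zero t₀ _).mono fun φ hφ => ?_)
  have h1 := h.sin_half_pos.ne'
  have h2 := h.cos_half_pos.ne'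
  -- The point term of `Λ` is rewritten through `(f ∘ φ)'(t₀) = φ'(t₀) / (2 S(1/2) C(1/2))`, which
  -- turns `4 a S(1/2) / C(1/2)` into the defect coefficient `8 a S(1/2)²`.
  have hexp : 2 * a * φ.energy / σ ^ 2
      = (2 * a * φ.energy - 4 * a * S (1 / 2) / C (1 / 2) * φ.derivative t₀) / σ ^ 2
        + 8 * a * S (1 / 2) ^ 2 / σ ^ 2 * (h.diffeo.comp φ).derivative t₀ := by
    rw [derivative_comp, hφ, h.derivative_diffeo_zero]
    field_simp
    ring
  beta_reduce
  rw [hexp, Real.exp_add, ENNReal.ofReal_mul (Real.exp_pos _).le]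
  ring

end IsTrigPair

theorem mainTheorem7 (σ : ℝ) (hσ : 0 < σ)
    (a₀ : ℝ) (μ : Measure CircleDiff) (hμ : IsOrbitalMeasure σ a₀ μ)
    (t₀ : UnitAddCircle)
    (α : ℂ) (hα : (α ^ 2).im = 0) (hαπ : (α ^ 2).re < Real.pi ^ 2) :
    -- `f_α` is a reparametrisation of `[0, 1]` with constant Schwarzian `2 α²`
    IsIntervalDiff3 (fAlpha α) ∧
    (∀ t ∈ Icc (0 : ℝ) 1, schwarzian (fAlpha α) t = 2 * (α ^ 2).re) ∧
    -- `f_α`, seen as a map of the circle, belongs to `Diff¹(𝕋)`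
    ∃ f : CircleDiff,
      (∀ t ∈ Icc (0 : ℝ) 1, f (t : UnitAddCircle) = (fAlpha α t : UnitAddCircle)) ∧
      -- the identity for nonnegative functionals
      (∀ G : CircleDiff → ℝ≥0∞, Measurable G →
        ∫⁻ φ, G (f.comp φ) ∂(pinned t₀ (orbitalFamily σ a₀ μ (α ^ 2).re))
          = ENNReal.ofReal (alphaDivSin α) *
            ∫⁻ φ, G φ * ENNReal.ofReal (Real.exp (defectCoeff α / σ ^ 2 * φ.derivative t₀))
              ∂(pinned t₀ (orbitalFamily σ a₀ μ 0))) ∧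
      -- the identity for real functionals; both sides are integrable at the same time
      (∀ G : CircleDiff → ℝ, Measurable G →
        (Integrable (fun φ => G (f.comp φ)) (pinned t₀ (orbitalFamily σ a₀ μ (α ^ 2).re)) ↔
          Integrable (fun φ => G φ * Real.exp (defectCoeff α / σ ^ 2 * φ.derivative t₀))
            (pinned t₀ (orbitalFamily σ a₀ μ 0))) ∧
        ∫ φ, G (f.comp φ) ∂(pinned t₀ (orbitalFamily σ a₀ μ (α ^ 2).re))
          = alphaDivSin α *
            ∫ φ, G φ * Real.exp (defectCoeff α / σ ^ 2 * φ.derivative t₀)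
              ∂(pinned t₀ (orbitalFamily σ a₀ μ 0))) := by
  obtain ⟨C, S, h, hC, hS, h0⟩ := IsTrigPair.exists_of_sq_real hα hαπ
  have hf := h.fAlpha_eq_tanMap hC hS h0
  have hc := h.alphaDivSin_eq hC hS h0
  have hd := IsTrigPair.defectCoeff_eq hS
  have hlint := fun (G : CircleDiff → ℝ≥0∞) (hG : Measurable G) =>
    h.lintegral_diffeo_comp hμ t₀ hG
  rw [← hc, ← hd] at hlint
  have hpos : 0 < alphaDivSin α := hc ▸ h.diffeo.derivative_pos 0
  refine ⟨hf ▸ h.tanMap_isIntervalDiff3, fun t ht => hf ▸ h.schwarzian_tanMap ht, h.diffeo,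
    fun t ht => hf ▸ h.diffeo_coe ht, hlint, fun G hG => ?_⟩
  have hcomp : Measurable fun φ => h.diffeo.comp φ :=
    (continuous_comp continuous_const continuous_id).measurable
  have hD : Measurable fun φ : CircleDiff =>
      ENNReal.ofReal (Real.exp (defectCoeff α / σ ^ 2 * φ.derivative t₀)) :=
    measurable_ofReal_exp
      (continuous_const.mul (continuous_derivative_apply continuous_id continuous_const))
  -- The identity for all nonnegative functionals is an equality of measures, from which both
  -- integrability and the real-valued identity follow.
  have hmap : (pinned t₀ (orbitalFamily σ a₀ μ (α ^ 2).re)).map (fun φ => h.diffeo.comp φ)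
      = ENNReal.ofReal (alphaDivSin α) • (pinned t₀ (orbitalFamily σ a₀ μ 0)).withDensity
        fun φ => ENNReal.ofReal (Real.exp (defectCoeff α / σ ^ 2 * φ.derivative t₀)) := by
    refine Measure.ext_of_lintegral _ fun H hH => ?_
    rw [lintegral_map hH hcomp, hlint H hH, lintegral_smul_measure, smul_eq_mul,
      lintegral_withDensity_eq_lintegral_mul _ hD hH]
    simp only [Pi.mul_apply, mul_comm]
  have htop : ∀ᵐ φ ∂(pinned t₀ (orbitalFamily σ a₀ μ 0)),
      ENNReal.ofReal (Real.exp (defectCoeff α / σ ^ 2 * φ.derivative t₀)) < ∞ :=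
    Eventually.of_forall fun _ => ENNReal.ofReal_lt_top
  constructor
  · have hi := integrable_map_measure (μ := pinned t₀ (orbitalFamily σ a₀ μ (α ^ 2).re))
      hG.aestronglyMeasurable hcomp.aemeasurable
    rw [hmap, integrable_smul_measure (by simpa using hpos) ENNReal.ofReal_ne_top,
      integrable_withDensity_iff hD htop] at hi
    simp only [ENNReal.toReal_ofReal (Real.exp_pos _).le] at hi
    exact hi.symm
  · rw [← integral_map hcomp.aemeasurable hG.aestronglyMeasurable, hmap, integral_smul_measure,
      integral_withDensity_eq_integral_toReal_smul hD htop, ENNReal.toReal_ofReal hpos.le]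
    simp only [ENNReal.toReal_ofReal (Real.exp_pos _).le, smul_eq_mul, mul_comm]

end
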